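/- Let $n\ge 4$ be an even integer, let $u:\mathbb{R}^n\to\mathbb{R}$ be smooth, and let $g=e^{2u}|dx|^2$ be the associated conformal metric on $\mathbb{R}^n$. Let $R_g$ be the scalar curvature of $g$, and let $Q$ be its Q-curvature, that is, the function determined by $$(-\Delta)^{n/2}u=Q\,e^{nu}\quad\text{on }\mathbb{R}^n,$$ where $\Delta$ is the Euclidean Laplacian. Write $|\mathbb{S}^n|$ for the volume of the standard unit sphere $\mathbb{S}^n\subset\mathbb{R}^{n+1}$, and say that a condition holds "near infinity" if it holds outside some compact subset of $\mathbb{R}^n$. Assume that $(\mathbb{R}^n,g)$ is complete and that $g$ has finite total Q-curvature, i.e. $Qe^{nu}\in L^1(\mathbb{R}^n)$. 1. If $R_g\ge 0$ near infinity, then $$0\le\int_{\mathbb{R}^n}Qe^{nu}\,dx\le\frac{(n-1)!\,|\mathbb{S}^n|}{2}.$$ 2. If there are constants $C>0$ and $p\ge 0$ such that $R_g(x)\ge C|x|^{-p}$ near infinity, then $$\frac{(n-1)!\,|\mathbb{S}^n|}{2}\max\Big\{0,1-\frac p2\Big\}\le\int_{\mathbb{R}^n}Qe^{nu}\,dx\le\frac{(n-1)!\,|\mathbb{S}^n|}{2}.$$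 In particular, if there is a constant $C>0$ such that $R_g\ge C$ near infinity, then $$\int_{\mathbb{R}^n}Qe^{nu}\,dx=\frac{(n-1)!\,|\mathbb{S}^n|}{2}.$$ -/

import Mathlib

open MeasureTheory Set Filter Topology
open scoped ContDiff Manifold ENNReal

noncomputable section

namespace ConformalQ

/-! ### Riemannian metrics on `ℝⁿ` in the standard global chart

A metric is given by its matrix `(g_ij(x))` in the standard coordinates. -/

/-- The partial derivative `∂_i f` in the standard coordinates of `ℝⁿ`. -/
def partialDeriv {n : ℕ} (i : Fin n) (f : EuclideanSpace ℝ (Fin n) → ℝ)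
    (x : EuclideanSpace ℝ (Fin n)) : ℝ :=
  fderiv ℝ f x (EuclideanSpace.single i 1)

/-- Christoffel symbols of the Levi-Civita connection,
`Γ^k_ij = (1/2) ∑_l g^{kl} (∂_i g_jl + ∂_j g_il - ∂_l g_ij)`. -/
def christoffel {n : ℕ} (g : EuclideanSpace ℝ (Fin n) → Matrix (Fin n) (Fin n) ℝ)
    (k i j : Fin n) (x : EuclideanSpace ℝ (Fin n)) : ℝ :=
  (1 / 2) * ∑ l, (g x)⁻¹ k l *
    (partialDeriv i (fun y => g y j l) x + partialDeriv j (fun y => g y i l) x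
      - partialDeriv l (fun y => g y i j) x)

/-- Ricci curvature,
`Ric_ij = ∑_k (∂_k Γ^k_ij - ∂_j Γ^k_ik) + ∑_{k,l} (Γ^k_kl Γ^l_ij - Γ^k_jl Γ^l_ik)`. -/
def ricci {n : ℕ} (g : EuclideanSpace ℝ (Fin n) → Matrix (Fin n) (Fin n) ℝ)
    (i j : Fin n) (x : EuclideanSpace ℝ (Fin n)) : ℝ :=
  ∑ k, (partialDeriv k (christoffel g k i j) x - partialDeriv j (christoffel g k i k) x)
    + ∑ k, ∑ l, (christoffel g k k l x * christoffel g l i j x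
        - christoffel g k j l x * christoffel g l i k x)

/-- Scalar curvature, `R_g = ∑_{i,j} g^{ij} Ric_ij`. -/
def scalarCurvature {n : ℕ} (g : EuclideanSpace ℝ (Fin n) → Matrix (Fin n) (Fin n) ℝ)
    (x : EuclideanSpace ℝ (Fin n)) : ℝ :=
  ∑ i, ∑ j, (g x)⁻¹ i j * ricci g i j x

/-- The length `√(∑_{i,j} g_ij(x) v_i v_j)` of a tangent vector `v` at `x`. -/
def tangentNorm {n : ℕ} (g : EuclideanSpace ℝ (Fin n) → Matrix (Fin n) (Fin n) ℝ)
    (x v : EuclideanSpace ℝ (Fin n)) : ℝ :=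
  Real.sqrt (∑ i, ∑ j, g x i j * v i * v j)

/-- The Riemannian distance of `g`: the infimum of the `g`-lengths of the `C^1` paths between two
points. -/
def riemannianDist {n : ℕ} (g : EuclideanSpace ℝ (Fin n) → Matrix (Fin n) (Fin n) ℝ)
    (x y : EuclideanSpace ℝ (Fin n)) : ℝ≥0∞ :=
  letI : ∀ p : EuclideanSpace ℝ (Fin n), ENorm (TangentSpace 𝓘(ℝ, EuclideanSpace ℝ (Fin n)) p) :=
    fun p => ⟨fun v => ENNReal.ofReal (tangentNorm g p v)⟩
  Manifold.riemannianEDist 𝓘(ℝ, EuclideanSpace ℝ (Fin n)) x y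

/-- `(ℝⁿ, g)` is complete: every sequence that is Cauchy for the Riemannian distance converges
for it. -/
def IsCompleteMetric {n : ℕ} (g : EuclideanSpace ℝ (Fin n) → Matrix (Fin n) (Fin n) ℝ) : Prop :=
  ∀ s : ℕ → EuclideanSpace ℝ (Fin n),
    (∀ ε : ℝ≥0∞, 0 < ε → ∃ N : ℕ, ∀ k ≥ N, ∀ m ≥ N, riemannianDist g (s k) (s m) < ε) →
    ∃ x, Tendsto (fun k => riemannianDist g (s k) x) atTop (𝓝 0)

/-! ### Conformal metrics and their Q-curvature -/

/-- The conformal metric `e^{2u} |dx|²`. -/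
def conformalMetric {n : ℕ} (u : EuclideanSpace ℝ (Fin n) → ℝ) (x : EuclideanSpace ℝ (Fin n)) :
    Matrix (Fin n) (Fin n) ℝ :=
  Real.exp (2 * u x) • (1 : Matrix (Fin n) (Fin n) ℝ)

/-- The `k`-th power `(-Δ)^k` of the operator `-Δ`, where `Δ = ∑_i ∂_i²` on `ℝⁿ`. -/
def negLaplacianPow {n : ℕ} (k : ℕ) (u : EuclideanSpace ℝ (Fin n) → ℝ) :
    EuclideanSpace ℝ (Fin n) → ℝ :=
  (fun (f : EuclideanSpace ℝ (Fin n) → ℝ) x => -(Laplacian.laplacian f x))^[k] u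

/-- The Q-curvature of `e^{2u} |dx|²` on `ℝⁿ`, `n` even: the function `Q` with
`(-Δ)^{n/2} u = Q e^{nu}`. -/
def qCurvature {n : ℕ} (u : EuclideanSpace ℝ (Fin n) → ℝ) (x : EuclideanSpace ℝ (Fin n)) : ℝ :=
  Real.exp (-(n * u x)) * negLaplacianPow (n / 2) u x

/-- `|𝕊ⁿ|`, the volume of the unit sphere of `ℝⁿ⁺¹`. -/
def sphereVolume (n : ℕ) : ℝ :=
  (volume : Measure (EuclideanSpace ℝ (Fin (n + 1)))).toSphere.real univ

end ConformalQ

end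

/-! Everything is read off the spherical mean `ū(r)` of `u` about the origin. Let `α` be the total
Q-curvature divided by `(n-1)!|𝕊ⁿ|/2`, and write `n = d + 2`. The claim becomes `max 0 (1 - p/2) ≤ α
≤ 1`.

If `R_g ≥ 0` near infinity, then `Δu ≤ -(d/2)|∇u|²` there, and by Jensen the mean satisfies the
radial Riccati inequality `Δū ≤ -(d/2)ū'²`. Since `e^{(d/2)ū}` is then a positive radial
superharmonic function near infinity, `r ū'(r) ≥ -2`; monotonicity of the flux `r^{n-1}ū'` bounds `r
ū'` above by a multiple of `r^{-d}`. So `r ū'` is bounded (`RadialRiccati.bounded`).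

The spherical integrals of `u, -Δu, …, (-Δ)^{n/2}u` form a chain of radial ODEs. Its top flux
converges because `Q e^{nu}` is integrable, and boundedness of `r ū'` forces every constant of
integration to vanish on the way down. Hence `r ū'(r) → -α` (`RadialChain.tendsto_mul_deriv`),
without any integral representation of `u`.

Lower bounds: the upper estimate for `r ū'` tends to `0`, so `α ≥ 0`. If `R_g ≥ C|x|^{-p}` and `α <
1 - p/2`, then `e^{2ū}` decays so slowly that `r²Δū → -∞`, which is incompatible with a finite limit
of `r ū'` (`one_sub_half_le_of_laplacian_le`).

Upper bound: if `α > 1`, then `ū ≤ K - β log r` with `β > 1`. The function `e^{(d/2)u}` is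
superharmonic near infinity, so its mean values around a point where `u ≤ ū` control `∫ e^u` over
annuli. Summing dyadically, `e^u/|x|^{n-1}` is integrable near infinity, so some ray has finite
length, whereas completeness makes every ray infinitely long
(`not_isCompleteMetric_of_sphericalMean_le`). -/

noncomputable section

namespace ConformalQ

/-- Euclidean `n`-space. -/
abbrev Euc (n : ℕ) := EuclideanSpace ℝ (Fin n)

/-- The surface measure of the unit sphere of `ℝⁿ`. -/
def sphereMeasure (n : ℕ) : Measure (Metric.sphere (0 : Euc n) 1) :=
  (volume : Measure (Euc n)).toSphere

instance (n : ℕ) : IsFiniteMeasure (sphereMeasure n) := by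
  unfold sphereMeasure; infer_instance

/-- The integral of `h` over the sphere of centre `c` and radius `r`, with respect to the surface
measure of the unit sphere. -/
def sphereIntegral {n : ℕ} (h : Euc n → ℝ) (c : Euc n) (r : ℝ) : ℝ :=
  ∫ s, h (c + r • (s : Euc n)) ∂sphereMeasure n

/-! ### Integrals over the unit sphere -/

theorem integrable_sphere {n : ℕ} {g : Metric.sphere (0 : Euc n) 1 → ℝ} (hg : Continuous g) :
    Integrable g (sphereMeasure n) :=
  hg.integrable_of_hasCompactSupport (HasCompactSupport.of_compactSpace _)

theorem hasDerivAt_integral_of_continuous {X : Type*} [TopologicalSpace X] [CompactSpace X]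
    [MeasurableSpace X] [OpensMeasurableSpace X] {μ : Measure X} [IsFiniteMeasure μ]
    {K K' : ℝ → X → ℝ} (hK : ∀ t, Continuous (K t)) (hK' : Continuous K'.uncurry)
    (hd : ∀ t s, HasDerivAt (fun τ => K τ s) (K' t s) t) (t : ℝ) :
    HasDerivAt (fun τ => ∫ s, K τ s ∂μ) (∫ s, K' t s ∂μ) t := by
  obtain ⟨C, hC⟩ : ∃ C, ∀ p ∈ Icc (t - 1) (t + 1) ×ˢ (univ : Set X), ‖K'.uncurry p‖ ≤ C :=
    (isCompact_Icc.prod isCompact_univ).exists_bound_of_continuousOn hK'.continuousOn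
  have hm : ∀ τ, Integrable (K τ) μ := fun τ =>
    (hK τ).integrable_of_hasCompactSupport (HasCompactSupport.of_compactSpace _)
  have hc' : Continuous (K' t) := hK'.comp (by fun_prop : Continuous fun s : X => (t, s))
  refine (hasDerivAt_integral_of_dominated_loc_of_deriv_le (s := Icc (t - 1) (t + 1))
    (bound := fun _ => C) (Icc_mem_nhds (by linarith) (by linarith))
    (Eventually.of_forall fun τ => (hm τ).aestronglyMeasurable) (hm t)
    (hc'.integrable_of_hasCompactSupport
      (HasCompactSupport.of_compactSpace _)).aestronglyMeasurable
    (Eventually.of_forall fun s τ hτ => hC (τ, s) ⟨hτ, mem_univ _⟩) (integrable_const C)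
    (Eventually.of_forall fun s τ _ => hd τ s)).2

theorem continuous_sphereIntegral {n : ℕ} {h : Euc n → ℝ} (hh : Continuous h) (c : Euc n) :
    Continuous (sphereIntegral h c) := by
  have := continuous_parametric_integral_of_continuous (μ := sphereMeasure n)
    (f := fun (r : ℝ) (s : Metric.sphere (0 : Euc n) 1) => h (c + r • (s : Euc n)))
    (by unfold Function.uncurry; fun_prop) (isCompact_univ)
  unfold sphereIntegral
  simpa using this

/-! ### Rotation invariance -/

/-- Linear isometries act on the unit sphere. -/
def sphereMap {n : ℕ} (A : Euc n ≃ₗᵢ[ℝ] Euc n) (s : Metric.sphere (0 : Euc n) 1) :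
    Metric.sphere (0 : Euc n) 1 :=
  ⟨A s, by simp⟩

theorem continuous_sphereMap {n : ℕ} (A : Euc n ≃ₗᵢ[ℝ] Euc n) : Continuous (sphereMap A) := by
  unfold sphereMap; fun_prop

-- The sphere measure of a set is a dimensional multiple of the volume of the cone over it, and a
-- linear isometry carries cones to cones and preserves volume.
open scoped Pointwise in
theorem measurePreserving_sphereMap {n : ℕ} (A : Euc n ≃ₗᵢ[ℝ] Euc n) :
    MeasurePreserving (sphereMap A) (sphereMeasure n) (sphereMeasure n) := by
  refine ⟨(continuous_sphereMap A).measurable, Measure.ext fun s hs => ?_⟩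
  have hs' := (continuous_sphereMap A).measurable hs
  rw [Measure.map_apply (continuous_sphereMap A).measurable hs, sphereMeasure,
    Measure.toSphere_apply' _ hs, Measure.toSphere_apply' _ hs']
  congr 1
  rw [← (A.measurePreserving).measure_preimage_equiv (f := A.toMeasurableEquiv)
    (Ioo (0 : ℝ) 1 • (Subtype.val '' s))]
  congr 1
  ext x
  simp only [Set.mem_smul, mem_image, mem_preimage]
  constructor
  · rintro ⟨r, hr, _, ⟨y, hy, rfl⟩, rfl⟩
    exact ⟨r, hr, A y, ⟨sphereMap A y, hy, rfl⟩, by simp⟩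
  · rintro ⟨r, hr, _, ⟨y, hy, rfl⟩, h⟩
    refine ⟨r, hr, A.symm y, ⟨⟨A.symm y, by simp⟩, ?_, rfl⟩, ?_⟩
    · convert hy using 1; ext; simp [sphereMap]
    · apply A.injective
      simpa using h

/-- The rotation by the angle `θ` in the plane of two orthonormal vectors. -/
def planeRotation {n : ℕ} {a b : Euc n} (ha : ‖a‖ = 1) (hb : ‖b‖ = 1) (hab : inner ℝ a b = 0)
    (θ : ℝ) : Euc n ≃ₗᵢ[ℝ] Euc n :=
  LinearIsometry.toLinearIsometryEquiv
    { toFun := fun x => x + ((Real.cos θ - 1) * inner ℝ a x + Real.sin θ * inner ℝ b x) • a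
        + ((Real.cos θ - 1) * inner ℝ b x - Real.sin θ * inner ℝ a x) • b
      map_add' := fun x y => by
        simp only [inner_add_right]; module
      map_smul' := fun c x => by
        simp only [inner_smul_right, RingHom.id_apply]; module
      norm_map' := fun x => by
        have haa : inner ℝ a a = (1 : ℝ) := by rw [real_inner_self_eq_norm_sq, ha]; norm_num
        have hbb : inner ℝ b b = (1 : ℝ) := by rw [real_inner_self_eq_norm_sq, hb]; norm_num
        have hba : inner ℝ b a = (0 : ℝ) := by rw [real_inner_comm, hab]
        have hcs := Real.sin_sq_add_cos_sq θ
        change ‖x + ((Real.cos θ - 1) * inner ℝ a x + Real.sin θ * inner ℝ b x) • a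
          + ((Real.cos θ - 1) * inner ℝ b x - Real.sin θ * inner ℝ a x) • b‖ = ‖x‖
        rw [← sq_eq_sq₀ (norm_nonneg _) (norm_nonneg _), ← real_inner_self_eq_norm_sq,
          ← real_inner_self_eq_norm_sq]
        simp only [inner_add_left, inner_add_right, inner_smul_left, inner_smul_right, haa, hbb,
          hba, hab, real_inner_comm a x, real_inner_comm b x, conj_trivial]
        linear_combination
          ((inner ℝ a x) ^ 2 + (inner ℝ b x) ^ 2 : ℝ) * hcs } rfl

/-- The derivative of `p` along the rotation field of a plane integrates to zero. -/
theorem integral_rotation_field {n : ℕ} {a b : Euc n} (ha : ‖a‖ = 1) (hb : ‖b‖ = 1)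
    (hab : inner ℝ a b = 0) {p : Euc n → ℝ} (hp : ContDiff ℝ 1 p) :
    ∫ s : Metric.sphere (0 : Euc n) 1,
      fderiv ℝ p s ((inner ℝ b (s : Euc n) : ℝ) • a - (inner ℝ a (s : Euc n) : ℝ) • b)
        ∂sphereMeasure n = 0 := by
  -- `R θ` is the rotation `planeRotation` written out, and `R' 0` is the field in the statement.
  -- The integral of `p ∘ R θ` does not depend on `θ`, so its derivative at `θ = 0` vanishes.
  let R : ℝ → Euc n → Euc n := fun θ x => x
    + ((Real.cos θ - 1) * inner ℝ a x + Real.sin θ * inner ℝ b x) • a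
    + ((Real.cos θ - 1) * inner ℝ b x - Real.sin θ * inner ℝ a x) • b
  let R' : ℝ → Euc n → Euc n := fun θ x =>
    (-Real.sin θ * inner ℝ a x + Real.cos θ * inner ℝ b x) • a
    + (-Real.sin θ * inner ℝ b x - Real.cos θ * inner ℝ a x) • b
  have hR : ∀ x θ, HasDerivAt (fun τ => R τ x) (R' θ x) θ := by
    intro x θ
    have h1 := (Real.hasDerivAt_cos θ).sub_const 1
    have h2 := Real.hasDerivAt_sin θ
    have h3 := (((h1.mul_const (inner ℝ a x : ℝ)).add
      (h2.mul_const (inner ℝ b x : ℝ))).smul_const a).const_add x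
    exact h3.add (((h1.mul_const (inner ℝ b x : ℝ)).sub
      (h2.mul_const (inner ℝ a x : ℝ))).smul_const b)
  have hpc : Continuous (fderiv ℝ p) := hp.continuous_fderiv one_ne_zero
  have hd := hasDerivAt_integral_of_continuous (μ := sphereMeasure n)
    (K := fun θ (s : Metric.sphere (0 : Euc n) 1) => p (R θ s))
    (K' := fun θ s => fderiv ℝ p (R θ s) (R' θ s))
    (fun θ => by have := hp.continuous; simp only [R]; fun_prop)
    (by simp only [R, R']; unfold Function.uncurry; fun_prop)
    (fun θ s => ((hp.differentiable one_ne_zero _).hasFDerivAt.comp_hasDerivAt θ (hR s θ))) 0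
  have hconst : (fun θ => ∫ s : Metric.sphere (0 : Euc n) 1, p (R θ s) ∂sphereMeasure n)
      = fun _ => ∫ s : Metric.sphere (0 : Euc n) 1, p s ∂sphereMeasure n := by
    funext θ
    have hmp := measurePreserving_sphereMap (planeRotation ha hb hab θ)
    rw [← hmp.integral_comp' (f := ⟨⟨sphereMap (planeRotation ha hb hab θ),
      sphereMap (planeRotation ha hb hab θ).symm, fun s => by ext; simp [sphereMap],
      fun s => by ext; simp [sphereMap]⟩, (continuous_sphereMap _).measurable,
      (continuous_sphereMap _).measurable⟩) (fun s => p s)]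
    rfl
  rw [hconst] at hd
  have h0 := hd.unique (hasDerivAt_const _ _)
  rw [← h0]
  congr 1
  funext s
  simp [R, R', sub_eq_add_neg]

/-! ### Laplacian and spherical means -/

theorem contDiff_partialDeriv {n : ℕ} {k : ℕ∞} {f : Euc n → ℝ} (hf : ContDiff ℝ (k + 1) f)
    (i : Fin n) : ContDiff ℝ k (partialDeriv i f) := by
  unfold partialDeriv
  exact (hf.fderiv_right le_rfl).clm_apply contDiff_const

theorem laplacian_eq_sum_partialDeriv {n : ℕ} {f : Euc n → ℝ} (hf : ContDiff ℝ 2 f) (x : Euc n) :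
    Laplacian.laplacian f x = ∑ i, partialDeriv i (partialDeriv i f) x := by
  have h := congrFun (InnerProductSpace.laplacian_eq_iteratedFDeriv_orthonormalBasis f
    (EuclideanSpace.basisFun (Fin n) ℝ)) x
  rw [h]
  refine Finset.sum_congr rfl fun i _ => ?_
  rw [iteratedFDeriv_two_apply]
  unfold partialDeriv
  have hd : DifferentiableAt ℝ (fderiv ℝ f) x :=
    (hf.fderiv_right (m := 1) (by norm_num)).differentiable one_ne_zero x
  rw [fderiv_clm_apply hd (differentiableAt_const _)]
  simp

theorem continuous_laplacian {n : ℕ} {f : Euc n → ℝ} (hf : ContDiff ℝ 2 f) :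
    Continuous (Laplacian.laplacian f) := by
  rw [funext (laplacian_eq_sum_partialDeriv hf)]
  refine continuous_finsetSum _ fun i _ => ?_
  exact (contDiff_partialDeriv (k := 0)
    (contDiff_partialDeriv (k := 1) (by exact_mod_cast hf) i) i).continuous

theorem fderiv_eq_sum_partialDeriv {n : ℕ} (f : Euc n → ℝ) (x v : Euc n) :
    fderiv ℝ f x v = ∑ i, partialDeriv i f x * v i := by
  have hv : v = ∑ i, v i • EuclideanSpace.single i (1 : ℝ) := by
    simpa using ((EuclideanSpace.basisFun (Fin n) ℝ).sum_repr v).symm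
  conv_lhs => rw [hv]
  rw [map_sum]
  refine Finset.sum_congr rfl fun i _ => ?_
  rw [map_smul, smul_eq_mul, mul_comm]; rfl

theorem sum_sq_sphere {n : ℕ} (s : Metric.sphere (0 : Euc n) 1) :
    ∑ i, (s : Euc n) i * (s : Euc n) i = 1 := by
  have h := EuclideanSpace.real_norm_sq_eq (s : Euc n)
  rw [norm_eq_of_mem_sphere] at h
  simp only [← pow_two]
  linarith

theorem fderiv_coord_mul {n : ℕ} (j : Fin n) {Y : Euc n → ℝ} {x : Euc n}
    (hY : DifferentiableAt ℝ Y x) (v : Euc n) :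
    fderiv ℝ (fun y : Euc n => y j * Y y) x v = v j * Y x + x j * fderiv ℝ Y x v := by
  have hc : HasFDerivAt (fun y : Euc n => y j) (EuclideanSpace.proj j : Euc n →L[ℝ] ℝ) x :=
    (EuclideanSpace.proj j : Euc n →L[ℝ] ℝ).hasFDerivAt
  rw [HasFDerivAt.fderiv (f := fun y : Euc n => y j * Y y) (hc.mul hY.hasFDerivAt)]
  simp; ring

/-- The divergence theorem on the unit sphere, for the normal part of a vector field. -/
theorem integral_sphere_divergence {n : ℕ} {Y : Fin n → Euc n → ℝ}
    (hY : ∀ i, ContDiff ℝ 1 (Y i)) :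
    ∫ s : Metric.sphere (0 : Euc n) 1, ∑ i, partialDeriv i (Y i) s ∂sphereMeasure n
      = ∫ s : Metric.sphere (0 : Euc n) 1, ∑ i, fderiv ℝ (Y i) s s * (s : Euc n) i
          ∂sphereMeasure n
        + ((n : ℝ) - 1) * ∫ s : Metric.sphere (0 : Euc n) 1, ∑ i, Y i s * (s : Euc n) i
          ∂sphereMeasure n := by
  -- `J i j` is the rotation field of the coordinate plane `(i, j)`. Applying rotation invariance to
  -- `y_j Y_i` and summing over `i, j` gives the formula: `∑ s_j² = 1` produces the divergence, and
  -- `∑_j (J i j s)_j = -(n-1) s_i` produces the factor `n - 1`.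
  let J : Fin n → Fin n → Euc n → Euc n := fun i j s =>
    s j • EuclideanSpace.single i (1 : ℝ) - s i • EuclideanSpace.single j (1 : ℝ)
  have hcY : ∀ i, Continuous (fderiv ℝ (Y i)) := fun i => (hY i).continuous_fderiv one_ne_zero
  have hcY0 : ∀ i, Continuous (Y i) := fun i => (hY i).continuous
  have hcJ : ∀ i j, Continuous (J i j) := fun i j => by simp only [J]; fun_prop
  have h0 : ∀ i j, ∫ s : Metric.sphere (0 : Euc n) 1,
      fderiv ℝ (fun y : Euc n => y j * Y i y) s (J i j s) ∂sphereMeasure n = 0 := by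
    intro i j
    by_cases hij : i = j
    · subst hij; simp [J]
    · have hab : inner ℝ (EuclideanSpace.single i (1 : ℝ) : Euc n)
          (EuclideanSpace.single j (1 : ℝ)) = 0 := by
        rw [EuclideanSpace.inner_single_left]; simp [hij]
      have := integral_rotation_field (by simp) (by simp) hab
        (p := fun y : Euc n => y j * Y i y) (ContDiff.mul (by fun_prop) (hY i))
      simpa only [J, EuclideanSpace.inner_single_left, map_one, one_mul] using this
  have h1 : ∫ s : Metric.sphere (0 : Euc n) 1, ∑ i, ∑ j,
      (J i j s j * Y i s + (s : Euc n) j * fderiv ℝ (Y i) s (J i j s)) ∂sphereMeasure n = 0 := by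
    rw [integral_finsetSum _ fun i _ => integrable_sphere (by fun_prop)]
    refine Finset.sum_eq_zero fun i _ => ?_
    rw [integral_finsetSum _ fun j _ => integrable_sphere (by fun_prop)]
    refine Finset.sum_eq_zero fun j _ => ?_
    rw [← h0 i j]
    refine integral_congr_ae (Eventually.of_forall fun s => ?_)
    simp only
    rw [fderiv_coord_mul j ((hY i).differentiable one_ne_zero _)]
  have h2 : ∀ s : Metric.sphere (0 : Euc n) 1, ∑ i, ∑ j,
      (J i j s j * Y i s + (s : Euc n) j * fderiv ℝ (Y i) s (J i j s))
      = ∑ i, partialDeriv i (Y i) s - ∑ i, fderiv ℝ (Y i) s s * (s : Euc n) i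
        - ((n : ℝ) - 1) * ∑ i, Y i s * (s : Euc n) i := by
    intro s
    have hs := sum_sq_sphere s
    rw [Finset.mul_sum, ← Finset.sum_sub_distrib, ← Finset.sum_sub_distrib]
    refine Finset.sum_congr rfl fun i _ => ?_
    have e1 : ∀ j, J i j s j * Y i s + (s : Euc n) j * fderiv ℝ (Y i) s (J i j s)
        = (if i = j then (s : Euc n) j * Y i s else 0) - (s : Euc n) i * Y i s
          + ((s : Euc n) j * (s : Euc n) j * partialDeriv i (Y i) s
          - (s : Euc n) i * (partialDeriv j (Y i) s * (s : Euc n) j)) := by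
      intro j
      simp only [J, map_sub, map_smul, smul_eq_mul, partialDeriv]
      by_cases hij : i = j
      · subst hij; simp; ring
      · have : ¬ j = i := fun h => hij h.symm
        simp [hij, this]; ring
    rw [Finset.sum_congr rfl fun j _ => e1 j, Finset.sum_add_distrib, Finset.sum_sub_distrib,
      Finset.sum_sub_distrib, ← Finset.sum_mul (f := fun j => (s : Euc n) j * (s : Euc n) j), hs,
      ← Finset.mul_sum (f := fun j => partialDeriv j (Y i) s * (s : Euc n) j),
      ← fderiv_eq_sum_partialDeriv]
    simp; ring
  have hcp : ∀ i, Continuous (partialDeriv i (Y i)) := fun i => by unfold partialDeriv; fun_prop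
  rw [integral_congr_ae (Eventually.of_forall h2), integral_sub, integral_sub,
    integral_const_mul] at h1
  · linarith
  all_goals exact integrable_sphere (by fun_prop)

/-- The integral of the radial derivative over a sphere. -/
def sphereFlux {n : ℕ} (h : Euc n → ℝ) (c : Euc n) (r : ℝ) : ℝ :=
  ∫ s, fderiv ℝ h (c + r • (s : Euc n)) s ∂sphereMeasure n

theorem hasDerivAt_sphereIntegral {n : ℕ} {h : Euc n → ℝ} (hh : ContDiff ℝ 1 h) (c : Euc n)
    (r : ℝ) : HasDerivAt (sphereIntegral h c) (sphereFlux h c r) r := by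
  have h1 : Continuous (fderiv ℝ h) := hh.continuous_fderiv one_ne_zero
  have h0 := hh.continuous
  refine hasDerivAt_integral_of_continuous (K' := fun r (s : Metric.sphere (0 : Euc n) 1) =>
    fderiv ℝ h (c + r • (s : Euc n)) s) (fun t => by fun_prop)
    (by unfold Function.uncurry; fun_prop) (fun t s => ?_) r
  have := ((hasDerivAt_id t).smul_const (s : Euc n)).const_add c
  rw [one_smul] at this
  exact (hh.differentiable one_ne_zero _).hasFDerivAt.comp_hasDerivAt t this

theorem continuous_sphereFlux {n : ℕ} {h : Euc n → ℝ} (hh : ContDiff ℝ 1 h) (c : Euc n) :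
    Continuous (sphereFlux h c) := by
  have h1 : Continuous (fderiv ℝ h) := hh.continuous_fderiv one_ne_zero
  have := continuous_parametric_integral_of_continuous (μ := sphereMeasure n)
    (f := fun (r : ℝ) (s : Metric.sphere (0 : Euc n) 1) => fderiv ℝ h (c + r • (s : Euc n)) s)
    (by unfold Function.uncurry; fun_prop) (isCompact_univ)
  unfold sphereFlux
  simpa using this

/-- The radial form of the divergence theorem, from which all later ODEs come. It is
`integral_sphere_divergence` for the field `x ↦ ∇h(c + r x)`; that identity is multiplied by
`r^(n-2)` rather than divided by `r`, so `r = 0` needs no separate treatment. -/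
theorem hasDerivAt_pow_mul_sphereFlux {n : ℕ} (hn : 2 ≤ n) {h : Euc n → ℝ} (hh : ContDiff ℝ 2 h)
    (c : Euc n) (r : ℝ) :
    HasDerivAt (fun t => t ^ (n - 1) * sphereFlux h c t)
      (r ^ (n - 1) * sphereIntegral (Laplacian.laplacian h) c r) r := by
  have hp : ∀ i, ContDiff ℝ 1 (partialDeriv i h) := fun i =>
    contDiff_partialDeriv (k := 1) (by exact_mod_cast hh) i
  have hpc : ∀ i, Continuous (partialDeriv i h) := fun i => (hp i).continuous
  have hpf : ∀ i, Continuous (fderiv ℝ (partialDeriv i h)) := fun i =>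
    (hp i).continuous_fderiv one_ne_zero
  have hflux : sphereFlux h c = fun t => ∫ s : Metric.sphere (0 : Euc n) 1,
      ∑ i, partialDeriv i h (c + t • (s : Euc n)) * (s : Euc n) i ∂sphereMeasure n := by
    funext t
    exact integral_congr_ae (Eventually.of_forall fun s => fderiv_eq_sum_partialDeriv _ _ _)
  have hd := hasDerivAt_integral_of_continuous (μ := sphereMeasure n)
    (K := fun t (s : Metric.sphere (0 : Euc n) 1) =>
      ∑ i, partialDeriv i h (c + t • (s : Euc n)) * (s : Euc n) i)
    (K' := fun t s => ∑ i, fderiv ℝ (partialDeriv i h) (c + t • (s : Euc n)) s * (s : Euc n) i)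
    (fun t => by fun_prop) (by unfold Function.uncurry; fun_prop)
    (fun t s => by
      refine HasDerivAt.fun_sum fun i _ => HasDerivAt.mul_const ?_ _
      have := ((hasDerivAt_id t).smul_const (s : Euc n)).const_add c
      rw [one_smul] at this
      exact ((hp i).differentiable one_ne_zero _).hasFDerivAt.comp_hasDerivAt t this) r
  have hdiv := integral_sphere_divergence (Y := fun i x => partialDeriv i h (c + r • x))
    (fun i => (hp i).comp (by fun_prop))
  have hfd : ∀ (i : Fin n) (x v : Euc n),
      fderiv ℝ (fun x => partialDeriv i h (c + r • x)) x v
        = r * fderiv ℝ (partialDeriv i h) (c + r • x) v := by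
    intro i x v
    have hin : HasFDerivAt (fun x : Euc n => c + r • x) (r • ContinuousLinearMap.id ℝ (Euc n)) x :=
      ((hasFDerivAt_id x).const_smul r).const_add c
    have := ((hp i).differentiable one_ne_zero (c + r • x)).hasFDerivAt.comp x hin
    rw [HasFDerivAt.fderiv (f := fun x => partialDeriv i h (c + r • x)) this]
    simp
  have hA : ∫ s : Metric.sphere (0 : Euc n) 1,
      ∑ i, partialDeriv i (fun x => partialDeriv i h (c + r • x)) s ∂sphereMeasure n
      = r * sphereIntegral (Laplacian.laplacian h) c r := by
    rw [sphereIntegral, ← integral_const_mul]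
    refine integral_congr_ae (Eventually.of_forall fun s => ?_)
    simp only
    rw [laplacian_eq_sum_partialDeriv hh, Finset.mul_sum]
    exact Finset.sum_congr rfl fun i _ => hfd i _ _
  have hB : ∫ s : Metric.sphere (0 : Euc n) 1,
      ∑ i, fderiv ℝ (fun x => partialDeriv i h (c + r • x)) s s * (s : Euc n) i ∂sphereMeasure n
      = r * ∫ s : Metric.sphere (0 : Euc n) 1, ∑ i,
        fderiv ℝ (partialDeriv i h) (c + r • (s : Euc n)) s * (s : Euc n) i ∂sphereMeasure n := by
    rw [← integral_const_mul]
    refine integral_congr_ae (Eventually.of_forall fun s => ?_)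
    simp only
    rw [Finset.mul_sum]
    exact Finset.sum_congr rfl fun i _ => by rw [hfd, mul_assoc]
  rw [hA, hB] at hdiv
  rw [hflux]
  refine ((hasDerivAt_pow (n - 1) r).mul hd).congr_deriv ?_
  obtain ⟨k, rfl⟩ : ∃ k, n = k + 2 := ⟨n - 2, by omega⟩
  rw [show k + 2 - 1 = k + 1 from rfl, Nat.add_sub_cancel]
  push_cast at hdiv ⊢
  linear_combination -r ^ k * hdiv

/-! ### Polar coordinates -/

theorem measurePreserving_polar (n : ℕ) :
    MeasurePreserving (homeomorphUnitSphereProd (Euc n))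
      ((volume : Measure (Euc n)).comap Subtype.val)
      ((sphereMeasure n).prod (Measure.volumeIoiPow (n - 1))) := by
  have := (volume : Measure (Euc n)).measurePreserving_homeomorphUnitSphereProd
  rwa [finrank_euclideanSpace_fin] at this

theorem homeomorphUnitSphereProd_smul {n : ℕ} (x : ({0}ᶜ : Set (Euc n))) :
    ((homeomorphUnitSphereProd (Euc n) x).2 : ℝ) •
      ((homeomorphUnitSphereProd (Euc n) x).1 : Euc n) = x := by
  conv_rhs => rw [← (homeomorphUnitSphereProd (Euc n)).symm_apply_apply x]
  rfl

theorem restrict_compl_zero {n : ℕ} (hn : 0 < n) :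
    (volume : Measure (Euc n)).restrict {0}ᶜ = volume := by
  have : Nonempty (Fin n) := ⟨⟨0, hn⟩⟩
  exact restrict_compl_singleton 0

/-- The order of integration, with the sphere outside, makes the inner integral one along a single
ray, which is where completeness enters. -/
theorem lintegral_polar_swap {n : ℕ} (hn : 0 < n) {f : Euc n → ℝ≥0∞} (hf : Measurable f) :
    ∫⁻ x, f x = ∫⁻ s : Metric.sphere (0 : Euc n) 1, ∫⁻ r in Ioi (0 : ℝ),
      ENNReal.ofReal (r ^ (n - 1)) * f (r • (s : Euc n)) ∂volume ∂sphereMeasure n := by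
  have hms : MeasurableSet ({0}ᶜ : Set (Euc n)) := (measurableSet_singleton _).compl
  calc ∫⁻ x, f x = ∫⁻ x in {0}ᶜ, f x := by rw [restrict_compl_zero hn]
    _ = ∫⁻ x : ({0}ᶜ : Set (Euc n)), f x ∂(volume.comap Subtype.val) :=
      (lintegral_subtype_comap hms f).symm
    _ = ∫⁻ p : Metric.sphere (0 : Euc n) 1 × Ioi (0 : ℝ), f ((p.2 : ℝ) • (p.1 : Euc n))
          ∂((sphereMeasure n).prod (Measure.volumeIoiPow (n - 1))) := by
      rw [← (measurePreserving_polar n).lintegral_comp (by fun_prop)]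
      simp only [homeomorphUnitSphereProd_smul]
    _ = ∫⁻ s : Metric.sphere (0 : Euc n) 1, ∫⁻ r : Ioi (0 : ℝ), f ((r : ℝ) • (s : Euc n))
          ∂Measure.volumeIoiPow (n - 1) ∂sphereMeasure n := by
      rw [lintegral_prod]
      exact Measurable.aemeasurable (by fun_prop)
    _ = _ := by
      refine lintegral_congr fun s => ?_
      rw [Measure.volumeIoiPow, lintegral_withDensity_eq_lintegral_mul _ (by fun_prop)
        (by fun_prop)]
      exact lintegral_subtype_comap measurableSet_Ioi
        (fun r : ℝ => ENNReal.ofReal (r ^ (n - 1)) * f (r • (s : Euc n)))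

theorem integral_polar {n : ℕ} (hn : 0 < n) {f : Euc n → ℝ} (hf : Integrable f) (c : Euc n) :
    IntegrableOn (fun r => r ^ (n - 1) * sphereIntegral f c r) (Ioi 0) ∧
    ∫ x, f x = ∫ r in Ioi (0 : ℝ), r ^ (n - 1) * sphereIntegral f c r := by
  have hms : MeasurableSet ({0}ᶜ : Set (Euc n)) := (measurableSet_singleton _).compl
  have hemb := (homeomorphUnitSphereProd (Euc n)).measurableEmbedding
  let g : Metric.sphere (0 : Euc n) 1 × Ioi (0 : ℝ) → ℝ := fun p =>
    f (c + (p.2 : ℝ) • (p.1 : Euc n))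
  have hg : Integrable g ((sphereMeasure n).prod (Measure.volumeIoiPow (n - 1))) := by
    rw [← (measurePreserving_polar n).integrable_comp_emb hemb]
    simp only [g, Function.comp_def, homeomorphUnitSphereProd_smul]
    have := (hf.comp_add_left c).integrableOn (s := {0}ᶜ)
    rwa [integrableOn_iff_comap_subtypeVal hms] at this
  have heq : ∫ x, f x = ∫ p, g p ∂((sphereMeasure n).prod (Measure.volumeIoiPow (n - 1))) := by
    rw [← (measurePreserving_polar n).integral_comp hemb]
    simp only [g, homeomorphUnitSphereProd_smul]
    rw [integral_subtype_comap hms (fun x => f (c + x)), restrict_compl_zero hn,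
      integral_add_left_eq_self f c]
  have hd : ∀ r : Ioi (0 : ℝ), (Real.toNNReal ((r : ℝ) ^ (n - 1)) : ℝ) = (r : ℝ) ^ (n - 1) :=
    fun r => Real.coe_toNNReal _ (pow_nonneg r.2.out.le _)
  constructor
  · have h1 := hg.integral_prod_right
    rw [Measure.volumeIoiPow] at h1
    have h2 := (integrable_withDensity_iff_integrable_smul (μ := Measure.comap Subtype.val volume)
      (f := fun r : Ioi (0 : ℝ) => Real.toNNReal ((r : ℝ) ^ (n - 1))) (by fun_prop)).1 h1
    rw [integrableOn_iff_comap_subtypeVal measurableSet_Ioi]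
    refine h2.congr (Eventually.of_forall fun r => ?_)
    simp only [NNReal.smul_def, hd, smul_eq_mul, Function.comp]
    rfl
  · rw [heq, integral_prod_symm _ hg, Measure.volumeIoiPow]
    have h2 := integral_withDensity_eq_integral_smul (μ := Measure.comap Subtype.val volume)
      (f := fun r : Ioi (0 : ℝ) => Real.toNNReal ((r : ℝ) ^ (n - 1))) (by fun_prop)
      (fun r => ∫ s, g (s, r) ∂sphereMeasure n)
    refine h2.trans ?_
    simp only [NNReal.smul_def, hd, smul_eq_mul]
    exact integral_subtype_comap measurableSet_Ioi
      (fun r : ℝ => r ^ (n - 1) * sphereIntegral f c r)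

/-! ### Asymptotics of radial polyharmonic functions -/

theorem abs_sub_le_of_abs_deriv_le {k k' B B' : ℝ → ℝ} {R : ℝ}
    (hk : ∀ r ≥ R, HasDerivAt k (k' r) r) (hB : ∀ r ≥ R, HasDerivAt B (B' r) r)
    (hle : ∀ r ≥ R, |k' r| ≤ B' r) {r s : ℝ} (hr : R ≤ r) (hrs : r ≤ s) :
    |k s - k r| ≤ B s - B r := by
  have h1 : ∀ t ∈ Icc r s, R ≤ t := fun t ht => hr.trans ht.1
  refine image_norm_le_of_norm_deriv_right_le_deriv_boundary' (a := r) (b := s)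
    (f := fun t => k t - k r) (f' := k') (B := fun t => B t - B r) (B' := B')
    (fun t ht => ((hk t (h1 t ht)).sub_const _).continuousAt.continuousWithinAt)
    (fun t ht => ((hk t (h1 t (Ico_subset_Icc_self ht))).sub_const _).hasDerivWithinAt)
    (by simp)
    (fun t ht => ((hB t (h1 t ht)).sub_const _).continuousAt.continuousWithinAt)
    (fun t ht => ((hB t (h1 t (Ico_subset_Icc_self ht))).sub_const _).hasDerivWithinAt)
    (fun t ht => hle t (h1 t (Ico_subset_Icc_self ht))) ⟨hrs, le_rfl⟩

/-- A l'Hôpital rule for a divergent integral: beyond the point where `|h - A| < ε/2`, the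
derivative of `g - A r^(b+1)/(b+1)` is dominated by that of `(ε/2) r^(b+1)/(b+1)`, and dividing by
`r^(b+1)` removes the constant of integration. -/
theorem tendsto_div_pow_of_hasDerivAt {g h : ℝ → ℝ} {b : ℕ} {A R : ℝ}
    (hg : ∀ r ≥ R, HasDerivAt g (r ^ b * h r) r) (hh : Tendsto h atTop (𝓝 A)) :
    Tendsto (fun r => g r / r ^ (b + 1)) atTop (𝓝 (A / (b + 1))) := by
  have hb : (0 : ℝ) < b + 1 := by positivity
  have hpow : ∀ r : ℝ, HasDerivAt (fun t : ℝ => t ^ (b + 1)) ((b + 1) * r ^ b) r := fun r => by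
    simpa using hasDerivAt_pow (b + 1) r
  rw [Metric.tendsto_atTop]
  intro ε hε
  obtain ⟨R₁, hR₁⟩ := Metric.tendsto_atTop.1 hh (ε / 2) (by positivity)
  set R₂ := max R (max R₁ 1) with hR₂
  have hR2 : R ≤ R₂ := le_max_left _ _
  have hR21 : R₁ ≤ R₂ := (le_max_left _ _).trans (le_max_right _ _)
  have hR2p : 1 ≤ R₂ := (le_max_right _ _).trans (le_max_right _ _)
  have key : ∀ r ≥ R₂, |(g r - A / (b + 1) * r ^ (b + 1)) - (g R₂ - A / (b + 1) * R₂ ^ (b + 1))|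
      ≤ ε / 2 / (b + 1) * r ^ (b + 1) - ε / 2 / (b + 1) * R₂ ^ (b + 1) := by
    intro r hr
    refine abs_sub_le_of_abs_deriv_le (R := R₂)
      (k := fun r => g r - A / (b + 1) * r ^ (b + 1))
      (B := fun r => ε / 2 / (b + 1) * r ^ (b + 1))
      (k' := fun r => r ^ b * h r - A / (b + 1) * ((b + 1) * r ^ b))
      (B' := fun r => ε / 2 / (b + 1) * ((b + 1) * r ^ b))
      (fun t ht => (hg t (hR2.trans ht)).sub ((hpow t).const_mul _))
      (fun t ht => (hpow t).const_mul _) (fun t ht => ?_) le_rfl hr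
    have ht0 : 0 ≤ t := by linarith [hR2p.trans ht]
    have h2 := hR₁ t (hR21.trans ht)
    rw [Real.dist_eq] at h2
    have e1 : t ^ b * h t - A / (b + 1) * ((b + 1) * t ^ b) = t ^ b * (h t - A) := by
      field_simp
    have e2 : ε / 2 / (b + 1) * ((b + 1) * t ^ b) = t ^ b * (ε / 2) := by field_simp
    rw [e1, e2, abs_mul, abs_of_nonneg (pow_nonneg ht0 b)]
    gcongr
  set K := |g R₂ - A / (b + 1) * R₂ ^ (b + 1)| with hK
  have hlim : Tendsto (fun r : ℝ => K / r ^ (b + 1)) atTop (𝓝 0) :=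
    tendsto_const_nhds.div_atTop (tendsto_pow_atTop (by omega))
  obtain ⟨R₃, hR₃⟩ := Metric.tendsto_atTop.1 hlim (ε / 2) (by positivity)
  refine ⟨max R₂ R₃, fun r hr => ?_⟩
  have hr2 : R₂ ≤ r := (le_max_left _ _).trans hr
  have hr0 : 0 < r := by linarith
  have hp : 0 < r ^ (b + 1) := by positivity
  have h3 := hR₃ r ((le_max_right _ _).trans hr)
  rw [Real.dist_eq, sub_zero, abs_of_nonneg (by positivity), div_lt_iff₀ hp] at h3
  have h4 := key r hr2
  have h5 : |g r - A / (b + 1) * r ^ (b + 1)| ≤ ε / 2 / (b + 1) * r ^ (b + 1) + K := by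
    have := abs_sub_abs_le_abs_sub (g r - A / (b + 1) * r ^ (b + 1))
      (g R₂ - A / (b + 1) * R₂ ^ (b + 1))
    have h6 : 0 ≤ ε / 2 / (b + 1) * R₂ ^ (b + 1) := by positivity
    linarith
  have h7 : ε / 2 / (b + 1) ≤ ε / 2 := div_le_self (by positivity) (by linarith [b.cast_nonneg (α := ℝ)])
  rw [Real.dist_eq, show g r / r ^ (b + 1) - A / (b + 1)
    = (g r - A / (b + 1) * r ^ (b + 1)) / r ^ (b + 1) by field_simp, abs_div, abs_of_pos hp,
    div_lt_iff₀ hp]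
  have h8 : ε / 2 / (b + 1) * r ^ (b + 1) ≤ ε / 2 * r ^ (b + 1) := by gcongr
  linarith

/-- The counterpart for a convergent integral, where the constant of integration `L` survives. After
subtraction of the model primitive `-A/(c r^c)`, the oscillation of `g` beyond `r` is at most `ε/(c
r^c)`; this gives the Cauchy property, and letting the far endpoint go to infinity gives the rate.
-/
theorem exists_tendsto_of_hasDerivAt_div_pow {g h : ℝ → ℝ} {c : ℕ} (hc : 0 < c) {A R : ℝ}
    (hg : ∀ r ≥ R, HasDerivAt g (h r / r ^ (c + 1)) r) (hh : Tendsto h atTop (𝓝 A)) :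
    ∃ L, Tendsto g atTop (𝓝 L) ∧
      Tendsto (fun r => (g r - L) * r ^ c) atTop (𝓝 (-A / c)) := by
  have hc' : (0 : ℝ) < c := by exact_mod_cast hc
  have hinv : ∀ r : ℝ, 0 < r → HasDerivAt (fun t : ℝ => -(t ^ c)⁻¹) (c / r ^ (c + 1)) r := by
    intro r hr
    have h1 := ((hasDerivAt_pow c r).inv (by positivity)).neg
    refine h1.congr_deriv ?_
    obtain ⟨d, rfl⟩ : ∃ d, c = d + 1 := ⟨c - 1, by omega⟩
    rw [Nat.add_sub_cancel]
    field_simp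
    ring
  have est : ∀ ε > 0, ∃ R' ≥ (1 : ℝ), ∀ r ≥ R', ∀ s ≥ r,
      |(g s + A / c * (s ^ c)⁻¹) - (g r + A / c * (r ^ c)⁻¹)| ≤ ε / c * (r ^ c)⁻¹ := by
    intro ε hε
    obtain ⟨R₁, hR₁⟩ := Metric.tendsto_atTop.1 hh ε hε
    set R₂ := max R (max R₁ 1) with hR₂
    have hR2 : R ≤ R₂ := le_max_left _ _
    have hR21 : R₁ ≤ R₂ := (le_max_left _ _).trans (le_max_right _ _)
    have hR2p : 1 ≤ R₂ := (le_max_right _ _).trans (le_max_right _ _)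
    refine ⟨R₂, hR2p, fun r hr s hs => ?_⟩
    have := abs_sub_le_of_abs_deriv_le (R := R₂)
      (k := fun r => g r - A / c * -(r ^ c)⁻¹)
      (B := fun r => ε / c * -(r ^ c)⁻¹)
      (k' := fun r => h r / r ^ (c + 1) - A / c * (c / r ^ (c + 1)))
      (B' := fun r => ε / c * (c / r ^ (c + 1)))
      (fun t ht => (hg t (hR2.trans ht)).sub ((hinv t (by linarith)).const_mul _))
      (fun t ht => (hinv t (by linarith)).const_mul _) (fun t ht => ?_) hr hs
    · have h0 : 0 ≤ ε / c * (s ^ c)⁻¹ := by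
        have : 0 < s := by linarith
        positivity
      simp only [mul_neg, sub_neg_eq_add] at this
      linarith
    · have ht0 : 0 < t := by linarith [hR2p.trans ht]
      have h2 := hR₁ t (hR21.trans ht)
      rw [Real.dist_eq] at h2
      have e1 : h t / t ^ (c + 1) - A / c * (c / t ^ (c + 1)) = (h t - A) / t ^ (c + 1) := by
        field_simp
      have e2 : ε / c * (c / t ^ (c + 1)) = ε / t ^ (c + 1) := by field_simp
      rw [e1, e2, abs_div, abs_of_pos (pow_pos ht0 (c + 1))]
      gcongr
  have hz : Tendsto (fun r : ℝ => (r ^ c)⁻¹) atTop (𝓝 0) :=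
    (tendsto_pow_atTop hc.ne').inv_tendsto_atTop
  have hcau : CauchySeq (fun r => g r + A / c * (r ^ c)⁻¹) := by
    rw [Metric.cauchySeq_iff']
    intro ε hε
    obtain ⟨R', hR', hest⟩ := est (c * (ε / 2)) (by positivity)
    refine ⟨R', fun s hs => ?_⟩
    have h1 := hest R' le_rfl s hs
    have h2 : (R' ^ c)⁻¹ ≤ 1 := inv_le_one_of_one_le₀ (one_le_pow₀ hR')
    rw [Real.dist_eq]
    refine h1.trans_lt ?_
    rw [mul_div_cancel_left₀ _ hc'.ne']
    nlinarith
  obtain ⟨L, hL⟩ := cauchySeq_tendsto_of_complete hcau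
  refine ⟨L, ?_, ?_⟩
  · simpa using hL.sub (hz.const_mul (A / c))
  · rw [Metric.tendsto_atTop]
    intro ε hε
    obtain ⟨R', hR', hest⟩ := est (c * (ε / 2)) (by positivity)
    refine ⟨R', fun r hr => ?_⟩
    have hr0 : 0 < r := by linarith
    have h1 : |L - (g r + A / c * (r ^ c)⁻¹)| ≤ c * (ε / 2) / c * (r ^ c)⁻¹ :=
      le_of_tendsto (hL.sub_const _).abs
        ((eventually_ge_atTop r).mono fun s hs => hest r hr s hs)
    rw [mul_div_cancel_left₀ _ hc'.ne'] at h1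
    have hp : 0 < r ^ c := by positivity
    rw [Real.dist_eq, show (g r - L) * r ^ c - -A / c
      = -(L - (g r + A / c * (r ^ c)⁻¹)) * r ^ c by field_simp; ring, abs_mul, abs_neg,
      abs_of_pos hp]
    calc _ ≤ (ε / 2 * (r ^ c)⁻¹) * r ^ c := by gcongr
      _ = ε / 2 := by field_simp
      _ < ε := by linarith

/-- A chain `F 0, F 1, …` of radial functions in dimension `2m` in which each is minus the
Laplacian of the preceding one; `D k` is the derivative of `F k`. -/
structure RadialChain (m : ℕ) (F D : ℕ → ℝ → ℝ) : Prop where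
  hasDerivAt : ∀ k < m, ∀ r, HasDerivAt (F k) (D k r) r
  hasDerivAt_flux : ∀ k < m, ∀ r,
    HasDerivAt (fun t => t ^ (2 * m - 1) * D k t) (-(r ^ (2 * m - 1) * F (k + 1) r)) r
  bounded : ∃ K R : ℝ, ∀ r ≥ R, |r * D 0 r| ≤ K

/-- Growth propagates down the chain: `F (i+1) ~ c r^j` with `c ≠ 0` integrates twice to `F i ~ c'
r^(j+2)` with `c' ≠ 0`, and so on to `F 0`, which is `o(r^j)` for every `j ≥ 1` because `r * D 0 r`
is bounded. The condition `0 < i + j` leaves out only a finite limit of `F 0` itself. -/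
theorem RadialChain.not_tendsto {m : ℕ} {F D : ℕ → ℝ → ℝ} (H : RadialChain m F D) (i : ℕ) :
    i < m → ∀ j, 0 < i + j → ∀ c : ℝ, c ≠ 0 → ¬ Tendsto (fun r => F i r / r ^ j) atTop (𝓝 c) := by
  induction i with
  | zero =>
    intro hm j hj c hc hlim
    obtain ⟨K, R, hK⟩ := H.bounded
    obtain ⟨b, rfl⟩ : ∃ b, j = b + 1 := ⟨j - 1, by omega⟩
    have h1 : Tendsto (fun r => (r * D 0 r) / r ^ (b + 1)) atTop (𝓝 0) := by
      have h2 : Tendsto (fun r : ℝ => K / r ^ (b + 1)) atTop (𝓝 0) :=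
        tendsto_const_nhds.div_atTop (tendsto_pow_atTop (by omega))
      refine squeeze_zero_norm' ?_ h2
      filter_upwards [eventually_ge_atTop R, eventually_gt_atTop 0] with r hr hr0
      rw [Real.norm_eq_abs, abs_div, abs_of_pos (pow_pos hr0 _)]
      have := hK r hr
      gcongr
    have h3 := tendsto_div_pow_of_hasDerivAt (R := 1) (b := b) (g := F 0) (fun r hr => by
      refine (H.hasDerivAt 0 hm r).congr_deriv ?_
      have : r ≠ 0 := by linarith [show (1 : ℝ) ≤ r from hr]
      field_simp
      ring) h1
    rw [zero_div] at h3
    exact hc (tendsto_nhds_unique hlim h3)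
  | succ i ih =>
    intro hm j hj c hc hlim
    have h1 := tendsto_div_pow_of_hasDerivAt (R := 1) (b := 2 * m - 1 + j)
      (g := fun t => t ^ (2 * m - 1) * D i t) (h := fun r => -(F (i + 1) r / r ^ j))
      (fun r hr => by
        refine (H.hasDerivAt_flux i (by omega) r).congr_deriv ?_
        have : r ≠ 0 := by linarith [show (1 : ℝ) ≤ r from hr]
        rw [pow_add]; field_simp) hlim.neg
    have h2 := tendsto_div_pow_of_hasDerivAt (R := 1) (b := j + 1) (g := F i)
      (fun r hr => by
        refine (H.hasDerivAt i (by omega) r).congr_deriv ?_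
        have : r ≠ 0 := by linarith [show (1 : ℝ) ≤ r from hr]
        rw [pow_add, pow_add, pow_add]; field_simp) h1
    refine ih (by omega) (j + 1 + 1) (by omega) _ ?_ h2
    exact div_ne_zero (div_ne_zero (neg_ne_zero.2 hc) (by positivity)) (by positivity)

theorem RadialChain.tendsto_flux {m : ℕ} {F D : ℕ → ℝ → ℝ} (H : RadialChain m F D) {i : ℕ}
    (hi : i + 1 < m) {A : ℝ}
    (hA : Tendsto (fun r => F (i + 1) r * r ^ (2 * (i + 1))) atTop (𝓝 A)) :
    Tendsto (fun r => D i r * r ^ (2 * i + 1)) atTop (𝓝 (-A / (2 * (m - 1 - i)))) := by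
  -- The flux derivative then behaves like `-A r^(2d+1)`, whose integral diverges, so no constant of
  -- integration has to be determined.
  obtain ⟨d, rfl⟩ : ∃ d, m = i + d + 2 := ⟨m - i - 2, by omega⟩
  have h1 := tendsto_div_pow_of_hasDerivAt (R := 1) (b := 2 * d + 1)
    (g := fun t => t ^ (2 * (i + d + 2) - 1) * D i t)
    (h := fun r => -(F (i + 1) r * r ^ (2 * (i + 1))))
    (fun r hr => by
      refine (H.hasDerivAt_flux i (by omega) r).congr_deriv ?_
      rw [show 2 * (i + d + 2) - 1 = (2 * d + 1) + 2 * (i + 1) by omega, pow_add]; ring) hA.neg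
  have e : -A / (2 * (((i + d + 2 : ℕ) : ℝ) - 1 - i)) = -A / (((2 * d + 1 : ℕ) : ℝ) + 1) := by
    push_cast; congr 1; ring
  rw [e]
  refine h1.congr' ?_
  filter_upwards [eventually_gt_atTop 0] with r hr
  rw [show 2 * (i + d + 2) - 1 = (2 * d + 1 + 1) + (2 * i + 1) by omega, pow_add]
  field_simp

-- Descend from the top flux, whose limit is given, alternately integrating from infinity to get `F
-- (i+1)` and outward to get `D i`. The first operation divides by `2(i+1)` and the second by
-- `2(m-1-i)`; each family contributes `2^(m-1) (m-1)!`, whence the constant.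
open Nat in
theorem RadialChain.tendsto_mul_deriv {m : ℕ} (hm : 2 ≤ m) {F D : ℕ → ℝ → ℝ}
    (H : RadialChain m F D) {I : ℝ}
    (hI : Tendsto (fun r => r ^ (2 * m - 1) * D (m - 1) r) atTop (𝓝 (-I))) :
    Tendsto (fun r => r * D 0 r) atTop (𝓝 (-(I / (4 ^ (m - 1) * ((m - 1)! : ℝ) ^ 2)))) := by
  -- The induction runs on the distance `j` from the top of the chain. At each level the limit `L`
  -- of `F (i+1)` must be `0`, since otherwise `not_tendsto` is violated with exponent `0`.
  have down : ∀ j i : ℕ, i + 1 + j = m - 1 →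
      Tendsto (fun r => F (i + 1) r * r ^ (2 * (i + 1))) atTop
        (𝓝 (I * (i ! : ℝ) / (2 * 4 ^ j * (j ! : ℝ) * ((m - 1)! : ℝ)))) := by
    intro j
    induction j with
    | zero =>
      intro i hi
      obtain rfl : m = i + 2 := by omega
      obtain ⟨L, hL, hL2⟩ := exists_tendsto_of_hasDerivAt_div_pow (c := 2 * (i + 1)) (R := 1)
        (g := F (i + 1)) (by omega) (fun r hr => by
          refine (H.hasDerivAt (i + 1) (by omega) r).congr_deriv ?_
          have : r ≠ 0 := by linarith [show (1 : ℝ) ≤ r from hr]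
          rw [show 2 * (i + 2) - 1 = 2 * (i + 1) + 1 by omega,
            show i + 2 - 1 = i + 1 by omega]
          field_simp) hI
      have hL0 : L = 0 := by
        by_contra h
        exact H.not_tendsto (i + 1) (by omega) 0 (by omega) L h (by simpa using hL)
      subst hL0
      simp only [sub_zero, neg_neg] at hL2
      convert hL2 using 2
      rw [show i + 2 - 1 = i + 1 by omega, Nat.factorial_succ]
      push_cast
      have : (i ! : ℝ) ≠ 0 := by positivity
      field_simp
      simp
    | succ j ih =>
      intro i hi
      obtain rfl : m = i + j + 3 := by omega
      have h1 := H.tendsto_flux (by omega) (ih (i + 1) (by omega))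
      obtain ⟨L, hL, hL2⟩ := exists_tendsto_of_hasDerivAt_div_pow (c := 2 * (i + 1)) (R := 1)
        (g := F (i + 1)) (by omega) (fun r hr => by
          refine (H.hasDerivAt (i + 1) (by omega) r).congr_deriv ?_
          have : r ≠ 0 := by linarith [show (1 : ℝ) ≤ r from hr]
          field_simp) h1
      have hL0 : L = 0 := by
        by_contra h
        exact H.not_tendsto (i + 1) (by omega) 0 (by omega) L h (by simpa using hL)
      subst hL0
      simp only [sub_zero] at hL2
      convert hL2 using 2
      rw [Nat.factorial_succ j, Nat.factorial_succ i]
      push_cast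
      have : (i ! : ℝ) ≠ 0 := by positivity
      have : (j ! : ℝ) ≠ 0 := by positivity
      have : ((i + j + 3 - 1)! : ℝ) ≠ 0 := by positivity
      rw [show (i : ℝ) + j + 3 - 1 - (i + 1) = j + 1 by ring]
      field_simp
      ring
  obtain ⟨q, rfl⟩ : ∃ q, m = q + 2 := ⟨m - 2, by omega⟩
  have h1 := H.tendsto_flux (by omega) (down q 0 (by omega))
  simp only [mul_zero, zero_add, pow_one] at h1
  simp_rw [mul_comm _ (D 0 _)]
  convert h1 using 2
  rw [show q + 2 - 1 = q + 1 by omega, Nat.factorial_succ q]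
  push_cast
  have : (q ! : ℝ) ≠ 0 := by positivity
  rw [show (q : ℝ) + 2 - 1 - 0 = q + 1 by ring]
  simp only [Nat.factorial_zero, Nat.cast_one]
  field_simp
  ring

/-! ### The scalar curvature of a conformal metric -/

/-- `|∇u|²`. -/
def gradSq {n : ℕ} (u : Euc n → ℝ) (x : Euc n) : ℝ := ∑ i, partialDeriv i u x ^ 2

theorem conformalMetric_inv {n : ℕ} (u : Euc n → ℝ) (x : Euc n) :
    (conformalMetric u x)⁻¹ = Real.exp (-(2 * u x)) • (1 : Matrix (Fin n) (Fin n) ℝ) := by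
  refine Matrix.inv_eq_right_inv ?_
  rw [conformalMetric, Matrix.smul_mul, Matrix.mul_smul, smul_smul, ← Real.exp_add]
  simp

theorem partialDeriv_conformalMetric {n : ℕ} {u : Euc n → ℝ} (hu : ContDiff ℝ 1 u)
    (i j k : Fin n) (x : Euc n) :
    partialDeriv i (fun y => conformalMetric u y j k) x
      = if j = k then 2 * Real.exp (2 * u x) * partialDeriv i u x else 0 := by
  have hd : DifferentiableAt ℝ u x := hu.differentiable one_ne_zero x
  by_cases h : j = k
  · subst h
    simp only [conformalMetric, Matrix.smul_apply, Matrix.one_apply_eq, smul_eq_mul, mul_one,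
      if_true, partialDeriv]
    rw [((hd.hasFDerivAt.const_mul 2).exp).fderiv]
    simp; ring
  · simp [conformalMetric, h, partialDeriv]

theorem christoffel_conformalMetric {n : ℕ} {u : Euc n → ℝ} (hu : ContDiff ℝ 1 u)
    (k i j : Fin n) :
    christoffel (conformalMetric u) k i j = fun x =>
      (if k = j then partialDeriv i u x else 0) + (if k = i then partialDeriv j u x else 0)
        - (if i = j then partialDeriv k u x else 0) := by
  funext x
  have hexp : Real.exp (-(2 * u x)) * Real.exp (2 * u x) = 1 := by
    rw [← Real.exp_add]; simp
  unfold christoffel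
  simp only [partialDeriv_conformalMetric hu, conformalMetric_inv]
  simp only [Matrix.smul_apply, Matrix.one_apply, smul_eq_mul, mul_ite, mul_one, mul_zero, ite_mul,
    zero_mul, Finset.sum_ite_eq, Finset.mem_univ, if_true]
  rw [if_congr (eq_comm (a := j) (b := k)) rfl rfl, if_congr (eq_comm (a := i) (b := k)) rfl rfl]
  have e : ∀ (p : Prop) [Decidable p] (v : ℝ), (if p then 2 * Real.exp (2 * u x) * v else 0)
      = 2 * Real.exp (2 * u x) * (if p then v else 0) := fun p _ v => by split_ifs <;> simp
  rw [e, e, e]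
  linear_combination ((if k = j then partialDeriv i u x else 0)
    + (if k = i then partialDeriv j u x else 0) - (if i = j then partialDeriv k u x else 0)) * hexp

theorem partialDeriv_ite {n : ℕ} (p : Prop) [Decidable p] (i : Fin n) (f : Euc n → ℝ) (x : Euc n) :
    partialDeriv i (fun y => if p then f y else 0) x = if p then partialDeriv i f x else 0 := by
  split_ifs <;> simp [partialDeriv]

/-- The inverse metric is a multiple of the identity, so this trace is all that scalar curvature
needs and off-diagonal Ricci entries are never computed. -/
theorem ricci_conformalMetric_trace {n : ℕ} {u : Euc n → ℝ} (hu : ContDiff ℝ 2 u)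
    (x : Euc n) :
    ∑ i, ricci (conformalMetric u) i i x
      = -(2 * ((n : ℝ) - 1) * Laplacian.laplacian u x
        + ((n : ℝ) - 1) * ((n : ℝ) - 2) * gradSq u x) := by
  have hu1 : ContDiff ℝ 1 u := hu.of_le (by norm_num)
  have hd : ∀ i, DifferentiableAt ℝ (partialDeriv i u) x := fun i =>
    (contDiff_partialDeriv (k := 1) (by exact_mod_cast hu) i).differentiable one_ne_zero x
  have hdi : ∀ (p : Prop) [Decidable p] (i : Fin n),
      DifferentiableAt ℝ (fun y => if p then partialDeriv i u y else 0) x := by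
    intro p _ i
    split_ifs
    · exact hd i
    · exact differentiableAt_const _
  have hpart : ∀ l k i j : Fin n, partialDeriv l (christoffel (conformalMetric u) k i j) x
      = (if k = j then partialDeriv l (partialDeriv i u) x else 0)
        + (if k = i then partialDeriv l (partialDeriv j u) x else 0)
        - (if i = j then partialDeriv l (partialDeriv k u) x else 0) := by
    intro l k i j
    rw [christoffel_conformalMetric hu1]
    rw [← partialDeriv_ite (k = j) l (partialDeriv i u), ← partialDeriv_ite (k = i) l
      (partialDeriv j u), ← partialDeriv_ite (i = j) l (partialDeriv k u)]
    have := HasFDerivAt.fderiv (((hdi (k = j) i).hasFDerivAt.add (hdi (k = i) j).hasFDerivAt).sub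
      (hdi (i = j) k).hasFDerivAt)
    exact congrArg (fun L => L (EuclideanSpace.single l 1)) this
  rw [laplacian_eq_sum_partialDeriv hu, gradSq]
  set S := ∑ i, partialDeriv i (partialDeriv i u) x with hS
  set G := ∑ i, partialDeriv i u x ^ 2 with hG
  have key : ∀ i, ricci (conformalMetric u) i i x
      = (2 - (n : ℝ)) * partialDeriv i (partialDeriv i u) x - S
        + ((n : ℝ) - 2) * partialDeriv i u x ^ 2 - ((n : ℝ) - 2) * G := by
    intro i
    unfold ricci
    simp only [hpart]
    simp only [christoffel_conformalMetric hu1]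
    simp only [if_true, Finset.sum_sub_distrib, Finset.sum_add_distrib, add_mul, mul_add, sub_mul,
      mul_sub, ite_mul, mul_ite, zero_mul, mul_zero, Finset.sum_ite_eq, Finset.sum_ite_eq',
      Finset.mem_univ, Finset.sum_const, Finset.card_univ, Fintype.card_fin, nsmul_eq_mul,
      Finset.sum_ite_irrel, ← pow_two, ← hS, ← hG]
    ring
  rw [Finset.sum_congr rfl fun i _ => key i]
  simp only [Finset.sum_sub_distrib, Finset.sum_add_distrib, ← Finset.mul_sum, ← hS, ← hG]
  simp
  ring

theorem scalarCurvature_conformalMetric {n : ℕ} {u : Euc n → ℝ} (hu : ContDiff ℝ 2 u)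
    (x : Euc n) :
    scalarCurvature (conformalMetric u) x
      = -(Real.exp (-(2 * u x)) * (((n : ℝ) - 1) * (2 * Laplacian.laplacian u x
        + ((n : ℝ) - 2) * gradSq u x))) := by
  unfold scalarCurvature
  simp only [conformalMetric_inv, Matrix.smul_apply, Matrix.one_apply, smul_eq_mul, mul_ite,
    mul_one, mul_zero, ite_mul, zero_mul, Finset.sum_ite_eq, Finset.mem_univ, if_true]
  rw [← Finset.mul_sum, ricci_conformalMetric_trace hu]
  ring

/-! ### Volumes of spheres -/

theorem sphereMeasure_real_univ {m : ℕ} (hm : 0 < m) :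
    (sphereMeasure (2 * m)).real univ = 2 * Real.pi ^ m / ((m - 1).factorial : ℝ) := by
  have : Nonempty (Fin (2 * m)) := ⟨⟨0, by omega⟩⟩
  have hpi := Real.pi_pos
  obtain ⟨k, rfl⟩ : ∃ k, m = k + 1 := ⟨m - 1, by omega⟩
  rw [sphereMeasure, Measure.toSphere_real_apply_univ, finrank_euclideanSpace_fin, measureReal_def,
    EuclideanSpace.volume_ball, Fintype.card_fin, ENNReal.ofReal_one, one_pow, one_mul,
    show ((2 * (k + 1) : ℕ) : ℝ) / 2 + 1
      = ((k + 1 : ℕ) : ℝ) + 1 by push_cast; ring, Real.Gamma_nat_eq_factorial, pow_mul √Real.pi,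
    Real.sq_sqrt hpi.le]
  rw [ENNReal.toReal_ofReal (by positivity), Nat.factorial_succ, Nat.add_sub_cancel]
  push_cast
  field_simp

/-- Identifies the normalization in the theorem with the constant produced by the radial chain times
`|𝕊ⁿ⁻¹|`. The identity is Legendre's duplication formula for `Γ`. -/
theorem sphereVolume_even {m : ℕ} (hm : 0 < m) :
    ((2 * m - 1).factorial : ℝ) * sphereVolume (2 * m) / 2
      = (sphereMeasure (2 * m)).real univ * (4 ^ (m - 1) * ((m - 1).factorial : ℝ) ^ 2) := by
  have hpi := Real.pi_pos
  rw [sphereMeasure_real_univ hm]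
  obtain ⟨k, rfl⟩ : ∃ k, m = k + 1 := ⟨m - 1, by omega⟩
  have hG := Real.Gamma_mul_Gamma_add_half ((k + 1 : ℕ) : ℝ)
  have hpos : 0 < Real.Gamma (((k + 1 : ℕ) : ℝ) + 1 / 2) := Real.Gamma_pos_of_pos (by positivity)
  have hG2 : Real.Gamma (((2 * (k + 1) + 1 : ℕ) : ℝ) / 2 + 1)
      = (((k + 1 : ℕ) : ℝ) + 1 / 2) * Real.Gamma (((k + 1 : ℕ) : ℝ) + 1 / 2) := by
    rw [← Real.Gamma_add_one (by positivity)]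
    congr 1; push_cast; ring
  have h2 : (2 : ℝ) ^ (1 - 2 * ((k + 1 : ℕ) : ℝ)) = (2 ^ (2 * k + 1))⁻¹ := by
    rw [← Real.rpow_natCast, ← Real.rpow_neg (by norm_num)]
    congr 1; push_cast; ring
  rw [show ((k + 1 : ℕ) : ℝ) = (k : ℝ) + 1 by push_cast; rfl, Real.Gamma_nat_eq_factorial,
    show 2 * ((k : ℝ) + 1) = ((2 * k + 1 : ℕ) : ℝ) + 1 by push_cast; ring,
    Real.Gamma_nat_eq_factorial, show 1 - (((2 * k + 1 : ℕ) : ℝ) + 1)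
      = 1 - 2 * ((k + 1 : ℕ) : ℝ) by push_cast; ring, h2] at hG
  rw [sphereVolume, Measure.toSphere_real_apply_univ, finrank_euclideanSpace_fin, measureReal_def,
    EuclideanSpace.volume_ball, Fintype.card_fin, ENNReal.ofReal_one, one_pow, one_mul, hG2,
    ENNReal.toReal_ofReal (by positivity), pow_succ, pow_mul √Real.pi, Real.sq_sqrt hpi.le,
    Nat.add_sub_cancel, show 2 * (k + 1) - 1 = 2 * k + 1 by omega]
  rw [show ((k + 1 : ℕ) : ℝ) = (k : ℝ) + 1 by push_cast; rfl] at hpos ⊢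
  have hf : ((2 * k + 1).factorial : ℝ) * √Real.pi
      = (k.factorial : ℝ) * Real.Gamma ((k : ℝ) + 1 + 1 / 2) * 2 ^ (2 * k + 1) := by
    rw [hG]; field_simp
  have hk : (k.factorial : ℝ) ≠ 0 := by positivity
  have h4 : (4 : ℝ) ^ k * 2 = 2 ^ (2 * k + 1) := by
    rw [pow_succ, pow_mul]; norm_num
  rw [← h4] at hf
  generalize Real.Gamma ((k : ℝ) + 1 + 1 / 2) = Γ at hf hpos ⊢
  push_cast
  field_simp
  linear_combination hf

/-! ### Radial differential inequalities -/

theorem le_of_hasDerivAt_nonpos {f f' : ℝ → ℝ} {R : ℝ} (hf : ∀ t ≥ R, HasDerivAt f (f' t) t)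
    (hle : ∀ t ≥ R, f' t ≤ 0) {r s : ℝ} (hr : R ≤ r) (hrs : r ≤ s) : f s ≤ f r := by
  have h : AntitoneOn f (Ici R) := by
    refine antitoneOn_of_hasDerivWithinAt_nonpos (convex_Ici R) (f' := f')
      (fun t ht => (hf t ht).continuousAt.continuousWithinAt)
      (fun t ht => (hf t (interior_subset ht)).hasDerivWithinAt)
      (fun t ht => hle t (interior_subset ht))
  exact h hr (hr.trans hrs) hrs

/-- A radial function `v` on `ℝ^(d+2)` with derivative `h` and Laplacian `L` satisfying
`L ≤ -(d/2) h²` for `r ≥ R`. -/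
structure RadialRiccati (d : ℕ) (v h L : ℝ → ℝ) (R : ℝ) : Prop where
  one_le : 1 ≤ R
  hasDerivAt : ∀ r, HasDerivAt v (h r) r
  hasDerivAt_flux : ∀ r, HasDerivAt (fun t => t ^ (d + 1) * h t) (r ^ (d + 1) * L r) r
  le : ∀ r ≥ R, L r ≤ -((d : ℝ) / 2) * h r ^ 2

theorem hasDerivAt_inv_pow {d : ℕ} (hd : 0 < d) {r : ℝ} (hr : 0 < r) :
    HasDerivAt (fun t : ℝ => (t ^ d)⁻¹) (-(d / r ^ (d + 1))) r := by
  refine ((hasDerivAt_pow d r).inv (by positivity)).congr_deriv ?_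
  obtain ⟨e, rfl⟩ : ∃ e, d = e + 1 := ⟨d - 1, by omega⟩
  rw [Nat.add_sub_cancel]
  field_simp
  ring

/-- `Z = e^{(d/2)v}` is radially superharmonic beyond `R`, so its flux, a multiple of `q`, is
nonincreasing. A positive such function cannot fall faster than the fundamental solution `r^(-d)`:
`r Z' ≥ -d Z`, which is `r h ≥ -2`. -/
theorem RadialRiccati.neg_two_le {d : ℕ} (hd : 0 < d) {v h L : ℝ → ℝ} {R : ℝ}
    (H : RadialRiccati d v h L R) {r : ℝ} (hr : R ≤ r) : -2 ≤ r * h r := by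
  have hd' : (0 : ℝ) < d := by exact_mod_cast hd
  have hR := H.one_le
  have hr0 : 0 < r := by linarith
  set Z : ℝ → ℝ := fun t => Real.exp (d / 2 * v t) with hZ
  have hZd : ∀ t, HasDerivAt Z (Z t * (d / 2 * h t)) t := fun t =>
    ((H.hasDerivAt t).const_mul _).exp
  set q : ℝ → ℝ := fun t => t ^ (d + 1) * h t * Z t with hq
  have hqd : ∀ t, HasDerivAt q (t ^ (d + 1) * L t * Z t
      + t ^ (d + 1) * h t * (Z t * (d / 2 * h t))) t := fun t =>
    (H.hasDerivAt_flux t).mul (hZd t)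
  have hqa : ∀ s ≥ r, q s ≤ q r := fun s hs => by
    refine le_of_hasDerivAt_nonpos (R := R) (fun t _ => hqd t) (fun t ht => ?_) hr hs
    have ht0 : 0 < t := by linarith [show R ≤ t from ht]
    have h1 := H.le t ht
    have h2 : 0 < t ^ (d + 1) * Z t := by positivity
    nlinarith
  -- With `q s ≤ q r`, `Z' s` is at most `(d/2) q r / s^(d+1)`, which the derivative of the second
  -- term cancels. Letting `s → ∞` and using `Z > 0` makes the right-hand side nonnegative.
  have hP : ∀ s ≥ r, Z s + q r / 2 * (s ^ d)⁻¹ ≤ Z r + q r / 2 * (r ^ d)⁻¹ := fun s hs => by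
    refine le_of_hasDerivAt_nonpos (R := r) (f := fun s => Z s + q r / 2 * (s ^ d)⁻¹)
      (fun t ht => (hZd t).add ((hasDerivAt_inv_pow hd
        (hr0.trans_le ht)).const_mul (q r / 2))) (fun t ht => ?_) le_rfl hs
    have ht0 : 0 < t := hr0.trans_le ht
    have h1 := hqa t ht
    have h2 : Z t * (d / 2 * h t) = d / 2 * (q t / t ^ (d + 1)) := by
      simp only [hq]; field_simp
    have h3 : q t / t ^ (d + 1) ≤ q r / t ^ (d + 1) := by gcongr
    have h4 : q r / 2 * -(d / t ^ (d + 1)) = -(d / 2 * (q r / t ^ (d + 1))) := by ring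
    rw [h2, h4]
    nlinarith
  have hlim : Tendsto (fun s : ℝ => q r / 2 * (s ^ d)⁻¹) atTop (𝓝 (q r / 2 * 0)) :=
    ((tendsto_pow_atTop hd.ne').inv_tendsto_atTop).const_mul _
  rw [mul_zero] at hlim
  have h0 : 0 ≤ Z r + q r / 2 * (r ^ d)⁻¹ := by
    refine le_of_tendsto hlim ?_
    filter_upwards [eventually_ge_atTop r] with s hs
    have := hP s hs
    have : 0 < Z s := Real.exp_pos _
    linarith
  have h1 : q r / 2 * (r ^ d)⁻¹ = Z r * (r * h r / 2) := by
    simp only [hq]; rw [pow_succ]; field_simp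
  rw [h1] at h0
  have hZr : 0 < Z r := Real.exp_pos _
  have h2 : 0 ≤ Z r * (1 + r * h r / 2) := by linarith
  have h3 := nonneg_of_mul_nonneg_right h2 hZr
  linarith

theorem RadialRiccati.mul_deriv_le {d : ℕ} {v h L : ℝ → ℝ} {R : ℝ}
    (H : RadialRiccati d v h L R) {r : ℝ} (hr : R ≤ r) :
    r * h r ≤ R ^ (d + 1) * h R / r ^ d := by
  have hR := H.one_le
  have hr0 : 0 < r := by linarith
  have h1 : r ^ (d + 1) * h r ≤ R ^ (d + 1) * h R := by
    refine le_of_hasDerivAt_nonpos (R := R) (f := fun t => t ^ (d + 1) * h t)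
      (fun t _ => H.hasDerivAt_flux t) (fun t ht => ?_) le_rfl hr
    have ht0 : 0 < t := by linarith [show R ≤ t from ht]
    have h1 := H.le t ht
    have h2 : L t ≤ 0 := h1.trans (by
      have : 0 ≤ (d : ℝ) / 2 * h t ^ 2 := by positivity
      linarith)
    exact mul_nonpos_of_nonneg_of_nonpos (by positivity) h2
  rw [le_div_iff₀ (by positivity)]
  rw [pow_succ] at h1
  linarith

theorem RadialRiccati.bounded {d : ℕ} (hd : 0 < d) {v h L : ℝ → ℝ} {R : ℝ}
    (H : RadialRiccati d v h L R) : ∃ K, ∀ r ≥ R, |r * h r| ≤ K := by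
  have hR := H.one_le
  refine ⟨max 2 |R ^ (d + 1) * h R|, fun r hr => abs_le.2 ⟨?_, ?_⟩⟩
  · have := H.neg_two_le hd hr
    have := le_max_left 2 |R ^ (d + 1) * h R|
    linarith
  · refine (H.mul_deriv_le hr).trans (le_trans ?_ (le_max_right _ _))
    refine (le_abs_self _).trans ?_
    rw [abs_div]
    refine div_le_self (abs_nonneg _) ?_
    rw [abs_of_nonneg (by have : 0 ≤ r := by linarith [show R ≤ r from hr]
                          positivity)]
    exact one_le_pow₀ (hR.trans hr)

theorem RadialRiccati.limit_nonneg {d : ℕ} (hd : 0 < d) {v h L : ℝ → ℝ} {R α : ℝ}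
    (H : RadialRiccati d v h L R) (hα : Tendsto (fun r => r * h r) atTop (𝓝 (-α))) : 0 ≤ α := by
  have h0 : Tendsto (fun r : ℝ => R ^ (d + 1) * h R / r ^ d) atTop (𝓝 0) :=
    tendsto_const_nhds.div_atTop (tendsto_pow_atTop hd.ne')
  have := le_of_tendsto_of_tendsto hα h0
    ((eventually_ge_atTop R).mono fun r hr => H.mul_deriv_le hr)
  linarith

/-- Logarithmic bounds for `v` from the limit of `r v'(r)`. -/
theorem exists_log_le_of_tendsto {v h : ℝ → ℝ} {α β : ℝ} (hv : ∀ r, HasDerivAt v (h r) r)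
    (hα : Tendsto (fun r => r * h r) atTop (𝓝 (-α))) (hβ : α < β) :
    ∃ K, ∀ᶠ r in atTop, -β * Real.log r - K ≤ v r := by
  have h1 : ∀ᶠ r in atTop, -β ≤ r * h r := hα.eventually_const_le (by linarith)
  obtain ⟨R, hR⟩ := eventually_atTop.1 (h1.and (eventually_ge_atTop 1))
  have hR1 := (hR R le_rfl).2
  refine ⟨-(v R + β * Real.log R), ?_⟩
  filter_upwards [eventually_ge_atTop R] with r hr
  have := le_of_hasDerivAt_nonpos (R := R) (f := fun t => -v t - β * Real.log t)
    (fun t ht => (hv t).neg.sub ((Real.hasDerivAt_log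
      (by linarith [(hR t ht).2] : t ≠ 0)).const_mul β)) (fun t ht => by
      obtain ⟨h2, h3⟩ := hR t ht
      have ht0 : 0 < t := by linarith
      have h4 : -h t - β * t⁻¹ = -(t * h t + β) / t := by field_simp; ring
      rw [h4]
      exact div_nonpos_of_nonpos_of_nonneg (by linarith) ht0.le) le_rfl hr
  linarith

/-- If `α < 1 - p/2`, take `β` halfway between. Then `v ≥ -β log r - K`, and the hypothesis bounds
`r² L` above by a negative multiple of `r^(2-p-2β)`, with positive exponent. Integrating the flux
then pushes `r h` below any prescribed level. -/
theorem one_sub_half_le_of_laplacian_le {d : ℕ} (hd : 0 < d) {v h L : ℝ → ℝ} {R α c p : ℝ}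
    (hc : 0 < c) (hv : ∀ r, HasDerivAt v (h r) r)
    (hf : ∀ r, HasDerivAt (fun t => t ^ (d + 1) * h t) (r ^ (d + 1) * L r) r)
    (hL : ∀ r ≥ R, L r ≤ -(c * r ^ (-p) * Real.exp (2 * v r)))
    (hα : Tendsto (fun r => r * h r) atTop (𝓝 (-α))) : 1 - p / 2 ≤ α := by
  by_contra! hlt
  have hd' : (0 : ℝ) < d := by exact_mod_cast hd
  set β := (α + (1 - p / 2)) / 2 with hβ
  obtain ⟨K, hK⟩ := exists_log_le_of_tendsto hv hα (show α < β by linarith)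
  -- The flux estimate gives `r h ≤ -M/d + o(1)`; this `M` makes `M/d = |α| + 1`, which contradicts
  -- the limit `-α`.
  set M := d * (|α| + 1) with hM
  have hgrow : Tendsto (fun r : ℝ => c * Real.exp (-(2 * K)) * r ^ (2 - p - 2 * β)) atTop atTop :=
    (tendsto_rpow_atTop (by linarith)).const_mul_atTop (by positivity)
  have hev : ∀ᶠ r in atTop, r ^ (d + 1) * L r ≤ -(M * r ^ (d - 1)) := by
    filter_upwards [hK, hgrow.eventually_ge_atTop M, eventually_ge_atTop R,
      eventually_gt_atTop 0] with r h1 h2 h3 h4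
    have h5 : Real.exp (-(2 * K)) * r ^ (-(2 * β)) ≤ Real.exp (2 * v r) := by
      rw [Real.rpow_def_of_pos h4, ← Real.exp_add]
      exact Real.exp_le_exp.2 (by linarith)
    have h6 : r ^ (2 - p - 2 * β) = r ^ 2 * (r ^ (-p) * r ^ (-(2 * β))) := by
      rw [← Real.rpow_natCast r 2, ← Real.rpow_add h4, ← Real.rpow_add h4]
      congr 1; push_cast; ring
    have h7 : M ≤ r ^ 2 * (c * r ^ (-p) * Real.exp (2 * v r)) := by
      refine h2.trans ?_
      rw [h6]
      have : 0 < r ^ 2 * (c * r ^ (-p)) := by positivity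
      calc _ = r ^ 2 * (c * r ^ (-p)) * (Real.exp (-(2 * K)) * r ^ (-(2 * β))) := by ring
        _ ≤ r ^ 2 * (c * r ^ (-p)) * Real.exp (2 * v r) := by gcongr
        _ = _ := by ring
    have h8 := hL r h3
    have h9 : r ^ 2 * L r ≤ -M := by nlinarith [sq_nonneg r]
    rw [show d + 1 = (d - 1) + 2 by omega, pow_add]
    have : 0 < r ^ (d - 1) := by positivity
    nlinarith
  obtain ⟨R₁, hR₁⟩ := eventually_atTop.1 (hev.and (eventually_ge_atTop 1))
  set Q := R₁ ^ (d + 1) * h R₁ + M / d * R₁ ^ d with hQ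
  have hbd : ∀ r ≥ R₁, r * h r ≤ Q / r ^ d - M / d := by
    intro r hr
    have hr0 : 0 < r := by linarith [(hR₁ r hr).2]
    have := le_of_hasDerivAt_nonpos (R := R₁) (f := fun t => t ^ (d + 1) * h t + M / d * t ^ d)
      (fun t _ => (hf t).add ((hasDerivAt_pow d t).const_mul (M / d))) (fun t ht => by
        have h1 := (hR₁ t ht).1
        have h2 : M / d * (d * t ^ (d - 1)) = M * t ^ (d - 1) := by field_simp
        rw [h2]; linarith) le_rfl hr
    have hp : 0 < r ^ d := by positivity
    rw [show Q / r ^ d - M / d = (Q - M / d * r ^ d) / r ^ d by field_simp, le_div_iff₀ hp]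
    rw [pow_succ] at this
    linarith
  have hlim : Tendsto (fun r : ℝ => Q / r ^ d - M / d) atTop (𝓝 (0 - M / d)) :=
    (tendsto_const_nhds.div_atTop (tendsto_pow_atTop hd.ne')).sub_const _
  have h1 := le_of_tendsto_of_tendsto hα hlim ((eventually_ge_atTop R₁).mono hbd)
  have h2 : M / d = |α| + 1 := by rw [hM]; field_simp
  rw [h2] at h1
  linarith [le_abs_self α]

/-! ### The spherical means of `u` -/

/-- The area `|𝕊ⁿ⁻¹|` of the unit sphere of `ℝⁿ`. -/
def sphereArea (n : ℕ) : ℝ := (sphereMeasure n).real univ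

theorem sphereArea_pos {n : ℕ} (hn : 0 < n) : 0 < sphereArea n := by
  have : Nonempty (Fin n) := ⟨⟨0, hn⟩⟩
  rw [sphereArea, sphereMeasure, Measure.toSphere_real_apply_univ, finrank_euclideanSpace_fin]
  have : 0 < (volume : Measure (Euc n)).real (Metric.ball 0 1) :=
    ENNReal.toReal_pos (Metric.measure_ball_pos _ _ one_pos).ne' measure_ball_lt_top.ne
  positivity

/-- Jensen's inequality in tangent-line form: the linear term integrates to zero. The tangent bound
may be verified pointwise on `G`, so `G` need not be a function of `a`; this allows `|∇u|²` against
the radial derivative. -/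
theorem mul_le_integral_of_tangent {n : ℕ} (hn : 0 < n)
    {a G : Metric.sphere (0 : Euc n) 1 → ℝ} (ha : Continuous a) (hG : Continuous G) {A B : ℝ}
    (h : ∀ s, A + B * (a s - (∫ s, a s ∂sphereMeasure n) / sphereArea n) ≤ G s) :
    A * sphereArea n ≤ ∫ s, G s ∂sphereMeasure n := by
  have hω := sphereArea_pos hn
  have h1 := integral_mono (integrable_sphere (by fun_prop)) (integrable_sphere hG) h
  refine le_trans (le_of_eq ?_) h1
  rw [integral_add (integrable_sphere (by fun_prop)) (integrable_sphere (by fun_prop)),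
    integral_const_mul, integral_sub (integrable_sphere ha) (integrable_sphere (by fun_prop)),
    integral_const, integral_const, smul_eq_mul, smul_eq_mul]
  change _ = sphereArea n * A + B * (_ - sphereArea n * _)
  field_simp
  ring

theorem contDiff_two_of_smooth {n : ℕ} {f : Euc n → ℝ} (hf : ContDiff ℝ ∞ f) : ContDiff ℝ 2 f :=
  contDiff_infty.1 hf 2

theorem contDiff_laplacian {n : ℕ} {f : Euc n → ℝ} (hf : ContDiff ℝ ∞ f) :
    ContDiff ℝ ∞ (Laplacian.laplacian f) := by
  have h2 : ContDiff ℝ 2 f := contDiff_two_of_smooth hf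
  rw [funext (laplacian_eq_sum_partialDeriv h2)]
  refine ContDiff.sum fun i _ => ?_
  exact contDiff_partialDeriv (k := ⊤) (contDiff_partialDeriv (k := ⊤) hf i) i

theorem negLaplacianPow_succ {n : ℕ} (k : ℕ) (u : Euc n → ℝ) :
    negLaplacianPow (k + 1) u = fun x => -(Laplacian.laplacian (negLaplacianPow k u) x) := by
  unfold negLaplacianPow
  rw [Function.iterate_succ_apply']

theorem contDiff_negLaplacianPow {n : ℕ} {u : Euc n → ℝ} (hu : ContDiff ℝ ∞ u) (k : ℕ) :
    ContDiff ℝ ∞ (negLaplacianPow k u) := by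
  induction k with
  | zero => exact hu
  | succ k ih => rw [negLaplacianPow_succ]; exact (contDiff_laplacian ih).neg

theorem qCurvature_mul_exp {n : ℕ} (u : Euc n → ℝ) (x : Euc n) :
    qCurvature u x * Real.exp (n * u x) = negLaplacianPow (n / 2) u x := by
  rw [qCurvature, mul_right_comm, ← Real.exp_add]
  simp

theorem sphereIntegral_neg {n : ℕ} (f : Euc n → ℝ) (c : Euc n) (r : ℝ) :
    sphereIntegral (fun x => -f x) c r = -sphereIntegral f c r :=
  integral_neg _

theorem continuous_gradSq {n : ℕ} {u : Euc n → ℝ} (hu : ContDiff ℝ 1 u) :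
    Continuous (gradSq u) := by
  unfold gradSq
  have : ∀ i, Continuous (partialDeriv i u) := fun i =>
    (contDiff_partialDeriv (k := 0) (by exact_mod_cast hu) i).continuous
  fun_prop

theorem sq_fderiv_sphere_le_gradSq {n : ℕ} (u : Euc n → ℝ) (x : Euc n)
    (s : Metric.sphere (0 : Euc n) 1) : fderiv ℝ u x s ^ 2 ≤ gradSq u x := by
  rw [fderiv_eq_sum_partialDeriv]
  have h := Finset.sum_mul_sq_le_sq_mul_sq Finset.univ (fun i => partialDeriv i u x)
    (fun i => (s : Euc n) i)
  have hs := sum_sq_sphere s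
  simp only [← pow_two] at hs
  rw [hs, mul_one] at h
  exact h

/-- Curvature bounds in terms of `Δu` and `|∇u|²`. -/
theorem laplacian_le_of_scalarCurvature {n : ℕ} (hn : 2 ≤ n) {u : Euc n → ℝ}
    (hu : ContDiff ℝ 2 u) {x : Euc n} {b : ℝ} (h : b ≤ scalarCurvature (conformalMetric u) x) :
    Laplacian.laplacian u x
      ≤ -(((n : ℝ) - 2) / 2 * gradSq u x) - b / (2 * ((n : ℝ) - 1)) * Real.exp (2 * u x) := by
  have hn' : (0 : ℝ) < (n : ℝ) - 1 := by
    have : (2 : ℝ) ≤ n := by exact_mod_cast hn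
    linarith
  rw [scalarCurvature_conformalMetric hu] at h
  have he : Real.exp (-(2 * u x)) * Real.exp (2 * u x) = 1 := by
    rw [← Real.exp_add]; simp
  have h1 := mul_le_mul_of_nonneg_right h (Real.exp_pos (2 * u x)).le
  have h2 : -(Real.exp (-(2 * u x)) * (((n : ℝ) - 1) * (2 * Laplacian.laplacian u x
        + ((n : ℝ) - 2) * gradSq u x))) * Real.exp (2 * u x)
      = -(((n : ℝ) - 1) * (2 * Laplacian.laplacian u x + ((n : ℝ) - 2) * gradSq u x)) := by
    linear_combination (-(((n : ℝ) - 1) * (2 * Laplacian.laplacian u x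
        + ((n : ℝ) - 2) * gradSq u x))) * he
  rw [h2] at h1
  have h3 : b / (2 * ((n : ℝ) - 1)) * Real.exp (2 * u x)
      = (b * Real.exp (2 * u x)) / (2 * ((n : ℝ) - 1)) := by ring
  have h4 : (b * Real.exp (2 * u x)) / (2 * ((n : ℝ) - 1))
      ≤ -(Laplacian.laplacian u x) - ((n : ℝ) - 2) / 2 * gradSq u x := by
    rw [div_le_iff₀ (by positivity)]
    linarith
  rw [h3]; linarith

/-- The pointwise curvature bound is averaged and Jensen is used twice, for `t ↦ e^{2t}` and for `t
↦ t²`. Both terms carry nonpositive coefficients because `n ≥ 2` and `b ≥ 0`, so the inequalities go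
the right way. -/
theorem sphereIntegral_laplacian_le {n : ℕ} (hn : 2 ≤ n) {u : Euc n → ℝ} (hu : ContDiff ℝ 2 u)
    {r b : ℝ} (hr : 0 ≤ r) (hb : 0 ≤ b)
    (h : ∀ x : Euc n, ‖x‖ = r → b ≤ scalarCurvature (conformalMetric u) x) :
    sphereIntegral (Laplacian.laplacian u) 0 r / sphereArea n
      ≤ -(((n : ℝ) - 2) / 2 * (sphereFlux u 0 r / sphereArea n) ^ 2)
        - b / (2 * ((n : ℝ) - 1)) * Real.exp (2 * (sphereIntegral u 0 r / sphereArea n)) := by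
  have hn2 : (2 : ℝ) ≤ n := by exact_mod_cast hn
  have hω := sphereArea_pos (show 0 < n by omega)
  have hu1 : ContDiff ℝ 1 u := hu.of_le (by norm_num)
  have hc := hu.continuous
  have hcf : Continuous (fderiv ℝ u) := hu1.continuous_fderiv one_ne_zero
  have hcg := continuous_gradSq hu1
  have hcl := continuous_laplacian hu
  set ub := sphereIntegral u 0 r / sphereArea n with hub
  set fb := sphereFlux u 0 r / sphereArea n with hfb
  have h1 := mul_le_integral_of_tangent (n := n) (by omega)
    (a := fun s => u (0 + r • (s : Euc n))) (G := fun s => Real.exp (2 * u (0 + r • (s : Euc n))))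
    (A := Real.exp (2 * ub)) (B := 2 * Real.exp (2 * ub)) (by fun_prop) (by fun_prop) (fun s => by
      have := Real.add_one_le_exp (2 * (u (0 + r • (s : Euc n)) - ub))
      have h3 : Real.exp (2 * u (0 + r • (s : Euc n)))
        = Real.exp (2 * ub) * Real.exp (2 * (u (0 + r • (s : Euc n)) - ub)) := by
        rw [← Real.exp_add]; congr 1; ring
      rw [h3]
      change Real.exp (2 * ub) + 2 * Real.exp (2 * ub) * (u (0 + r • (s : Euc n)) - ub) ≤ _
      nlinarith [Real.exp_pos (2 * ub)])
  have h2 := mul_le_integral_of_tangent (n := n) (by omega)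
    (a := fun s => fderiv ℝ u (0 + r • (s : Euc n)) s) (G := fun s => gradSq u (0 + r • (s : Euc n)))
    (A := fb ^ 2) (B := 2 * fb) (by fun_prop) (by fun_prop) (fun s => by
      have := sq_fderiv_sphere_le_gradSq u (0 + r • (s : Euc n)) s
      refine le_trans ?_ this
      change fb ^ 2 + 2 * fb * (fderiv ℝ u (0 + r • (s : Euc n)) s - fb) ≤ _
      nlinarith [sq_nonneg (fderiv ℝ u (0 + r • (s : Euc n)) s - fb)])
  have h3 : sphereIntegral (Laplacian.laplacian u) 0 r
      ≤ ∫ s : Metric.sphere (0 : Euc n) 1, (-(((n : ℝ) - 2) / 2 * gradSq u (0 + r • (s : Euc n)))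
        - b / (2 * ((n : ℝ) - 1)) * Real.exp (2 * u (0 + r • (s : Euc n)))) ∂sphereMeasure n := by
    refine integral_mono (integrable_sphere (by fun_prop)) (integrable_sphere (by fun_prop))
      fun s => laplacian_le_of_scalarCurvature hn hu (h _ ?_)
    rw [zero_add, norm_smul, norm_eq_of_mem_sphere, mul_one, Real.norm_eq_abs, abs_of_nonneg hr]
  rw [integral_sub (integrable_sphere (by fun_prop)) (integrable_sphere (by fun_prop)),
    integral_neg, integral_const_mul, integral_const_mul] at h3
  rw [div_le_iff₀ hω]
  refine h3.trans ?_
  have h4 : 0 ≤ ((n : ℝ) - 2) / 2 := by linarith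
  have h5 : 0 ≤ b / (2 * ((n : ℝ) - 1)) := div_nonneg hb (by linarith)
  have h6 := mul_le_mul_of_nonneg_left h2 h4
  have h7 := mul_le_mul_of_nonneg_left h1 h5
  rw [sub_mul, neg_mul, mul_assoc, mul_assoc]
  linarith

/-- The mean of `u` over the sphere of radius `r` centred at the origin. -/
def sphericalMean {n : ℕ} (u : Euc n → ℝ) (r : ℝ) : ℝ := sphereIntegral u 0 r / sphereArea n

theorem hasDerivAt_sphericalMean {n : ℕ} {u : Euc n → ℝ} (hu : ContDiff ℝ 1 u) (r : ℝ) :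
    HasDerivAt (sphericalMean u) (sphereFlux u 0 r / sphereArea n) r :=
  (hasDerivAt_sphereIntegral hu 0 r).div_const _

theorem hasDerivAt_sphericalMean_flux {d : ℕ} {u : Euc (d + 2) → ℝ} (hu : ContDiff ℝ 2 u) (r : ℝ) :
    HasDerivAt (fun t => t ^ (d + 1) * (sphereFlux u 0 t / sphereArea (d + 2)))
      (r ^ (d + 1) * (sphereIntegral (Laplacian.laplacian u) 0 r / sphereArea (d + 2))) r := by
  have := (hasDerivAt_pow_mul_sphereFlux (by omega) hu 0 r).div_const (sphereArea (d + 2))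
  simp only [mul_div_assoc] at this
  exact this

theorem radialRiccati_sphericalMean {d : ℕ} {u : Euc (d + 2) → ℝ} (hu : ContDiff ℝ 2 u) {R : ℝ}
    (hR : 1 ≤ R)
    (h : ∀ x : Euc (d + 2), R ≤ ‖x‖ → 0 ≤ scalarCurvature (conformalMetric u) x) :
    RadialRiccati d (sphericalMean u) (fun r => sphereFlux u 0 r / sphereArea (d + 2))
      (fun r => sphereIntegral (Laplacian.laplacian u) 0 r / sphereArea (d + 2)) R where
  one_le := hR
  hasDerivAt := hasDerivAt_sphericalMean (hu.of_le (by norm_num))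
  hasDerivAt_flux := hasDerivAt_sphericalMean_flux hu
  le r hr := by
    have := sphereIntegral_laplacian_le (by omega) hu (r := r) (b := 0)
      (by linarith [show R ≤ r from hr]) le_rfl (fun x hx => h x (by rw [hx]; exact hr))
    rw [zero_div, zero_mul, sub_zero] at this
    refine this.trans (le_of_eq ?_)
    push_cast; ring

/-- If `r ū'(r)` is bounded, then it converges to minus the normalized total `Q`-curvature. -/
theorem tendsto_mul_deriv_sphericalMean {m : ℕ} (hm : 2 ≤ m) {u : Euc (2 * m) → ℝ}
    (hu : ContDiff ℝ ∞ u) (hint : Integrable (negLaplacianPow m u))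
    {K R : ℝ} (hK : ∀ r ≥ R, |r * (sphereFlux u 0 r / sphereArea (2 * m))| ≤ K) :
    Tendsto (fun r => r * (sphereFlux u 0 r / sphereArea (2 * m))) atTop
      (𝓝 (-((∫ x, negLaplacianPow m u x)
        / (((2 * m - 1).factorial : ℝ) * sphereVolume (2 * m) / 2)))) := by
  have hω := sphereArea_pos (show 0 < 2 * m by omega)
  have hk : ∀ k, ContDiff ℝ 2 (negLaplacianPow k u) := fun k =>
    contDiff_two_of_smooth (contDiff_negLaplacianPow hu k)
  have hflux : ∀ k r, HasDerivAt (fun t => t ^ (2 * m - 1) * sphereFlux (negLaplacianPow k u) 0 t)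
      (-(r ^ (2 * m - 1) * sphereIntegral (negLaplacianPow (k + 1) u) 0 r)) r := fun k r => by
    have := hasDerivAt_pow_mul_sphereFlux (by omega) (hk k) 0 r
    rw [negLaplacianPow_succ, sphereIntegral_neg]
    simpa using this
  -- The chain is made of sphere integrals rather than means; the area is divided out only at the
  -- end.
  have H : RadialChain m (fun k => sphereIntegral (negLaplacianPow k u) 0)
      (fun k => sphereFlux (negLaplacianPow k u) 0) :=
    { hasDerivAt := fun k _ r => hasDerivAt_sphereIntegral ((hk k).of_le (by norm_num)) 0 r
      hasDerivAt_flux := fun k _ r => hflux k r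
      bounded := ⟨K * sphereArea (2 * m), R, fun r hr => by
        have := hK r hr
        rw [← mul_div_assoc, abs_div, abs_of_pos hω, div_le_iff₀ hω] at this
        exact this⟩ }
  obtain ⟨hi1, hi2⟩ := integral_polar (n := 2 * m) (by omega) hint 0
  -- The flux at radius `r` is minus the integral of `(-Δ)^m u` over the ball, written in polar
  -- coordinates, and integrability lets the ball exhaust the space.
  have hI : Tendsto (fun r => r ^ (2 * m - 1) * sphereFlux (negLaplacianPow (m - 1) u) 0 r) atTop
      (𝓝 (-∫ x, negLaplacianPow m u x)) := by
    rw [hi2]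
    have h1 := (intervalIntegral_tendsto_integral_Ioi 0 hi1 tendsto_id).neg
    refine h1.congr fun r => ?_
    have h2 := intervalIntegral.integral_eq_sub_of_hasDerivAt (a := 0) (b := r)
      (fun t _ => hflux (m - 1) t) (by
        apply Continuous.intervalIntegrable
        have := continuous_sphereIntegral (hk (m - 1 + 1)).continuous 0
        fun_prop)
    rw [intervalIntegral.integral_neg, show m - 1 + 1 = m by omega,
      zero_pow (by omega), zero_mul, sub_zero] at h2
    exact h2
  have h1 := (H.tendsto_mul_deriv hm hI).div_const (sphereArea (2 * m))
  rw [sphereVolume_even (by omega)]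
  change Tendsto _ atTop (𝓝 (-((∫ x, negLaplacianPow m u x) / (sphereArea (2 * m) * _))))
  convert h1 using 2
  · exact (mul_div_assoc _ _ _).symm
  · rw [neg_div, div_div, mul_comm (sphereArea (2 * m))]

/-! ### Complete conformal metrics -/

theorem tangentNorm_conformalMetric {n : ℕ} (u : Euc n → ℝ) (x v : Euc n) :
    tangentNorm (conformalMetric u) x v = Real.exp (u x) * ‖v‖ := by
  have h : ∑ i, ∑ j, conformalMetric u x i j * v i * v j = (Real.exp (u x) * ‖v‖) ^ 2 := by
    rw [mul_pow, EuclideanSpace.real_norm_sq_eq, ← Real.exp_nat_mul, Finset.mul_sum]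
    refine Finset.sum_congr rfl fun i _ => ?_
    simp only [conformalMetric, Matrix.smul_apply, Matrix.one_apply, smul_eq_mul, mul_ite, mul_one,
      mul_zero, ite_mul, zero_mul, Finset.sum_ite_eq, Finset.mem_univ, if_true]
    push_cast
    ring
  rw [tangentNorm, h, Real.sqrt_sq (by positivity)]

/-- The extended norms on the tangent spaces given by the conformal metric. -/
@[reducible] def conformalENorm {n : ℕ} (u : Euc n → ℝ) :
    ∀ p : Euc n, ENorm (TangentSpace 𝓘(ℝ, Euc n) p) :=
  fun p => ⟨fun v => ENNReal.ofReal (tangentNorm (conformalMetric u) p v)⟩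

/-- Homogeneity makes path length insensitive to reversal and reparametrization, hence the distance
symmetric. -/
theorem conformalENorm_smul {n : ℕ} (u : Euc n → ℝ) (p : Euc n) :
    letI := conformalENorm u p
    ENormSMulClass ℝ (TangentSpace 𝓘(ℝ, Euc n) p) := by
  let := conformalENorm u p
  suffices key : ∀ (r : ℝ) (v : Euc n), ENNReal.ofReal (tangentNorm (conformalMetric u) p (r • v))
      = ‖r‖ₑ * ENNReal.ofReal (tangentNorm (conformalMetric u) p v) from ⟨fun r v => key r v⟩
  intro r v
  rw [tangentNorm_conformalMetric, tangentNorm_conformalMetric, norm_smul,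
    ← ofReal_norm, ← ENNReal.ofReal_mul (norm_nonneg r)]
  congr 1; ring

theorem riemannianDist_conformalMetric_comm {n : ℕ} (u : Euc n → ℝ) (x y : Euc n) :
    riemannianDist (conformalMetric u) x y = riemannianDist (conformalMetric u) y x := by
  let := conformalENorm u
  have := conformalENorm_smul u
  exact Manifold.riemannianEDist_comm

theorem riemannianDist_ray_le {n : ℕ} (u : Euc n → ℝ) {s : Euc n} (hs : ‖s‖ = 1) {a b : ℝ}
    (hab : a ≤ b) :
    riemannianDist (conformalMetric u) (a • s) (b • s)
      ≤ ∫⁻ t in Icc a b, ENNReal.ofReal (Real.exp (u (t • s))) := by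
  let := conformalENorm u
  have := conformalENorm_smul u
  have h := Manifold.riemannianEDist_le_pathELength (I := 𝓘(ℝ, Euc n)) (γ := fun t : ℝ => t • s)
    (a := a) (b := b) (x := a • s) (y := b • s)
    (contMDiffOn_iff_contDiffOn.2 (by fun_prop)) rfl rfl hab
  refine h.trans (le_of_eq ?_)
  rw [Manifold.pathELength_eq_lintegral_mfderiv_Icc]
  refine lintegral_congr fun t => ?_
  change ENNReal.ofReal (tangentNorm (conformalMetric u) (t • s)
    (mfderiv 𝓘(ℝ, ℝ) 𝓘(ℝ, Euc n) (fun t : ℝ => t • s) t (1 : ℝ))) = _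
  have hd : mfderiv 𝓘(ℝ, ℝ) 𝓘(ℝ, Euc n) (fun t : ℝ => t • s) t (1 : ℝ) = s := by
    rw [mfderiv_eq_fderiv]
    have : HasDerivAt (fun t : ℝ => t • s) ((1 : ℝ) • s) t := (hasDerivAt_id t).smul_const s
    rw [one_smul] at this
    have h2 : fderiv ℝ (fun t : ℝ => t • s) t 1 = s := by
      rw [fderiv_apply_one_eq_deriv, this.deriv]
    exact h2
  rw [hd, tangentNorm_conformalMetric, hs, mul_one]

/-- After its last time at Euclidean distance at least `1` from `x`, a path from `y` to `x` stays in
the closed unit ball, where `e^u ≥ δ`, and still has to cover Euclidean distance `1`. -/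
theorem le_riemannianDist {n : ℕ} {u : Euc n → ℝ} {x y : Euc n} {δ : ℝ}
    (hδ : ∀ z, ‖z - x‖ ≤ 1 → δ ≤ Real.exp (u z)) (hy : 1 ≤ ‖y - x‖) :
    ENNReal.ofReal δ ≤ riemannianDist (conformalMetric u) y x := by
  let := conformalENorm u
  by_contra! hlt
  obtain ⟨γ, h0, h1, hγ, hlen⟩ := Manifold.exists_lt_of_riemannianEDist_lt
    (I := 𝓘(ℝ, Euc n)) (x := y) (y := x) hlt
  have hγ' : ContDiffOn ℝ 1 γ (Icc 0 1) := contMDiffOn_iff_contDiffOn.1 hγ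
  have hcont : ContinuousOn (fun t => ‖γ t - x‖) (Icc (0 : ℝ) 1) :=
    (hγ'.continuousOn.sub continuousOn_const).norm
  set T := {t ∈ Icc (0 : ℝ) 1 | 1 ≤ ‖γ t - x‖} with hT
  have hTc : IsCompact T := by
    have : IsClosed T := hcont.preimage_isClosed_of_isClosed isClosed_Icc isClosed_Ici
    exact isCompact_Icc.of_isClosed_subset this fun t ht => ht.1
  have hTn : T.Nonempty := ⟨0, ⟨le_rfl, zero_le_one⟩, by rw [h0]; exact hy⟩
  obtain ⟨τ, hτT, hτmax⟩ := hTc.exists_isGreatest hTn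
  have hball : ∀ t ∈ Ioo τ 1, ‖γ t - x‖ ≤ 1 := by
    intro t ht
    by_contra! hc
    exact absurd (hτmax ⟨⟨hτT.1.1.trans ht.1.le, ht.2.le⟩, hc.le⟩) (not_le.2 ht.1)
  have hlow : ENNReal.ofReal δ * ‖γ 1 - γ τ‖ₑ
      ≤ Manifold.pathELength 𝓘(ℝ, Euc n) γ τ 1 := by
    have hsub : Icc τ 1 ⊆ Icc 0 1 := Icc_subset_Icc hτT.1.1 le_rfl
    have h2 := enorm_sub_le_lintegral_derivWithin_Icc_of_contDiffOn_Icc (hγ'.mono hsub) hτT.1.2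
    rw [Manifold.pathELength_eq_lintegral_mfderiv_Ioo]
    rw [← restrict_Ioo_eq_restrict_Icc] at h2
    refine (mul_le_mul_right h2 _).trans ?_
    rw [← lintegral_const_mul' _ _ ENNReal.ofReal_ne_top]
    refine setLIntegral_mono' measurableSet_Ioo fun t ht => ?_
    change _ ≤ ENNReal.ofReal (tangentNorm (conformalMetric u) (γ t)
      (mfderiv 𝓘(ℝ, ℝ) 𝓘(ℝ, Euc n) γ t (1 : ℝ)))
    have hd : (mfderiv 𝓘(ℝ, ℝ) 𝓘(ℝ, Euc n) γ t (1 : ℝ) : Euc n) = derivWithin γ (Icc τ 1) t := by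
      rw [derivWithin_of_mem_nhds (Icc_mem_nhds ht.1 ht.2), mfderiv_eq_fderiv]
      rfl
    rw [hd, tangentNorm_conformalMetric, ENNReal.ofReal_mul (Real.exp_pos _).le,
      ofReal_norm]
    gcongr
    exact hδ _ (hball t ht)
  have h3 : (1 : ℝ≥0∞) ≤ ‖γ 1 - γ τ‖ₑ := by
    rw [h1, ← ofReal_norm, norm_sub_rev, ← ENNReal.ofReal_one]
    exact ENNReal.ofReal_le_ofReal hτT.2
  have h4 : Manifold.pathELength 𝓘(ℝ, Euc n) γ τ 1 ≤ Manifold.pathELength 𝓘(ℝ, Euc n) γ 0 1 :=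
    Manifold.pathELength_mono hτT.1.1 le_rfl
  have h5 : ENNReal.ofReal δ * 1 ≤ ENNReal.ofReal δ * ‖γ 1 - γ τ‖ₑ := by gcongr
  rw [mul_one] at h5
  exact absurd hlen (not_lt.2 (h5.trans (hlow.trans h4)))

/-- In a complete conformal metric, every ray from the origin has infinite length. -/
theorem lintegral_ray_eq_top {n : ℕ} {u : Euc n → ℝ} (hu : Continuous u)
    (hc : IsCompleteMetric (conformalMetric u)) {s : Euc n} (hs : ‖s‖ = 1) (a : ℝ) :
    ∫⁻ t in Ioi a, ENNReal.ofReal (Real.exp (u (t • s))) = ⊤ := by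
  by_contra hfin
  set f : ℝ → ℝ≥0∞ := fun t => ENNReal.ofReal (Real.exp (u (t • s))) with hf
  -- If the ray had finite length, length along it would be a finite measure with vanishing tails,
  -- so the points `k • s` would be Cauchy.
  set ν := (volume.restrict (Ioi a)).withDensity f with hν
  have hνfin : IsFiniteMeasure ν := isFiniteMeasure_withDensity hfin
  have htail : Tendsto (fun k : ℕ => ν (Ioi (k : ℝ))) atTop (𝓝 0) := by
    have h := tendsto_measure_iInter_atTop (μ := ν) (s := fun k : ℕ => Ioi (k : ℝ))
      (fun k => measurableSet_Ioi.nullMeasurableSet)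
      (fun i j hij => Ioi_subset_Ioi (by exact_mod_cast hij)) ⟨0, measure_ne_top _ _⟩
    have he : ⋂ k : ℕ, Ioi (k : ℝ) = ∅ := by
      ext t
      simp only [mem_iInter, mem_Ioi, mem_empty_iff_false, iff_false, not_forall, not_lt]
      obtain ⟨k, hk⟩ := exists_nat_ge t
      exact ⟨k, hk⟩
    rwa [he, measure_empty] at h
  obtain ⟨A, hA⟩ := exists_nat_gt a
  have hdist : ∀ N k m : ℕ, A ≤ N → N < k → k ≤ m →
      riemannianDist (conformalMetric u) ((k : ℝ) • s) ((m : ℝ) • s) ≤ ν (Ioi (N : ℝ)) := by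
    intro N k m hAN hNk hkm
    refine (riemannianDist_ray_le u hs (by exact_mod_cast hkm)).trans ?_
    have hsub : Icc (k : ℝ) m ⊆ Ioi (N : ℝ) := fun t ht =>
      lt_of_lt_of_le (by exact_mod_cast hNk) ht.1
    have hsub2 : Ioi (N : ℝ) ⊆ Ioi a := Ioi_subset_Ioi (hA.le.trans (by exact_mod_cast hAN))
    rw [hν, withDensity_apply _ measurableSet_Ioi, Measure.restrict_restrict measurableSet_Ioi,
      inter_eq_left.2 hsub2]
    exact lintegral_mono_set hsub
  obtain ⟨x, hx⟩ := hc (fun k : ℕ => (k : ℝ) • s) (by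
    intro ε hε
    obtain ⟨N, hN⟩ := ((htail.eventually_lt_const hε).and (eventually_ge_atTop A)).exists
    refine ⟨N + 1, fun k hk m hm => ?_⟩
    rcases le_total k m with h | h
    · exact (hdist N k m hN.2 (by omega) h).trans_lt hN.1
    · rw [riemannianDist_conformalMetric_comm]
      exact (hdist N m k hN.2 (by omega) h).trans_lt hN.1)
  -- The points `k • s` eventually leave the unit ball about the limit `x`, so their distance to `x`
  -- is at least the minimum of `e^u` on that ball.
  obtain ⟨z, _, hz⟩ := (isCompact_closedBall x 1).exists_isMinOn
    ⟨x, Metric.mem_closedBall_self zero_le_one⟩ (Real.continuous_exp.comp hu).continuousOn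
  have hpos : 0 < ENNReal.ofReal (Real.exp (u z)) := ENNReal.ofReal_pos.2 (Real.exp_pos _)
  have h1 := hx.eventually_lt_const hpos
  obtain ⟨B, hB⟩ := exists_nat_ge (‖x‖ + 1)
  obtain ⟨k, hk1, hk2⟩ := (h1.and (eventually_ge_atTop B)).exists
  refine absurd hk1 (not_lt.2 (le_riemannianDist (fun w hw => ?_) ?_))
  · exact hz (by rwa [Metric.mem_closedBall, dist_eq_norm])
  · have h2 : ‖(k : ℝ) • s‖ = k := by rw [norm_smul, hs]; simp
    have h3 := norm_sub_norm_le ((k : ℝ) • s) x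
    have h4 : (B : ℝ) ≤ k := by exact_mod_cast hk2
    linarith

/-! ### Superharmonicity and mean values -/

theorem laplacian_exp_mul {n : ℕ} {u : Euc n → ℝ} (hu : ContDiff ℝ 2 u) (a : ℝ) (x : Euc n) :
    Laplacian.laplacian (fun y => Real.exp (a * u y)) x
      = a * Real.exp (a * u x) * (Laplacian.laplacian u x + a * gradSq u x) := by
  have hu1 : ContDiff ℝ 1 u := hu.of_le (by norm_num)
  have hw : ContDiff ℝ 2 (fun y => Real.exp (a * u y)) := (contDiff_const.mul hu).exp
  have hd : ∀ y, HasFDerivAt (fun y => Real.exp (a * u y))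
      (Real.exp (a * u y) • (a • fderiv ℝ u y)) y := fun y =>
    ((hu1.differentiable one_ne_zero y).hasFDerivAt.const_mul a).exp
  have hp : ∀ i, partialDeriv i (fun y => Real.exp (a * u y))
      = fun y => a * (Real.exp (a * u y) * partialDeriv i u y) := by
    intro i
    funext y
    rw [partialDeriv, (hd y).fderiv]
    simp only [FunLike.coe_smul, Pi.smul_apply, smul_eq_mul, partialDeriv]
    ring
  have hp2 : ∀ i, partialDeriv i (partialDeriv i (fun y => Real.exp (a * u y))) x
      = a * Real.exp (a * u x) * (partialDeriv i (partialDeriv i u) x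
        + a * partialDeriv i u x ^ 2) := by
    intro i
    have hdi : DifferentiableAt ℝ (partialDeriv i u) x :=
      (contDiff_partialDeriv (k := 1) (by exact_mod_cast hu) i).differentiable one_ne_zero x
    rw [hp i, partialDeriv, HasFDerivAt.fderiv
      (f := fun y => a * (Real.exp (a * u y) * partialDeriv i u y))
      (((hd x).mul hdi.hasFDerivAt).const_mul a)]
    simp only [FunLike.coe_smul, FunLike.coe_add, Pi.add_apply, Pi.smul_apply,
      smul_eq_mul, partialDeriv]
    ring
  rw [laplacian_eq_sum_partialDeriv hw, laplacian_eq_sum_partialDeriv hu, gradSq, Finset.mul_sum,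
    ← Finset.sum_add_distrib, Finset.mul_sum]
  exact Finset.sum_congr rfl fun i _ => hp2 i

theorem sphereIntegral_zero_radius {n : ℕ} (w : Euc n → ℝ) (c : Euc n) :
    sphereIntegral w c 0 = sphereArea n * w c := by
  simp [sphereIntegral, sphereArea]

theorem sphereIntegral_mono {n : ℕ} {f g : Euc n → ℝ} (hf : Continuous f) (hg : Continuous g)
    {c : Euc n} {r : ℝ} (h : ∀ s : Metric.sphere (0 : Euc n) 1,
      f (c + r • (s : Euc n)) ≤ g (c + r • (s : Euc n))) :
    sphereIntegral f c r ≤ sphereIntegral g c r :=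
  integral_mono (integrable_sphere (by fun_prop)) (integrable_sphere (by fun_prop)) h

/-- The positive part of the Laplacian. -/
def laplacianPos {n : ℕ} (w : Euc n → ℝ) (x : Euc n) : ℝ := max (Laplacian.laplacian w x) 0

theorem continuous_laplacianPos {n : ℕ} {w : Euc n → ℝ} (hw : ContDiff ℝ 2 w) :
    Continuous (laplacianPos w) :=
  (continuous_laplacian hw).max continuous_const

theorem integrable_laplacianPos {n : ℕ} {w : Euc n → ℝ} (hw : ContDiff ℝ 2 w) {R : ℝ}
    (h : ∀ x : Euc n, R ≤ ‖x‖ → Laplacian.laplacian w x ≤ 0) : Integrable (laplacianPos w) := by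
  refine (continuous_laplacianPos hw).integrable_of_hasCompactSupport ?_
  refine HasCompactSupport.of_support_subset_isCompact (isCompact_closedBall 0 R) fun x hx => ?_
  rw [mem_closedBall_zero_iff]
  by_contra! hlt
  exact hx (max_eq_right (h x hlt.le))

theorem pow_mul_sphereFlux_eq {d : ℕ} {w : Euc (d + 2) → ℝ} (hw : ContDiff ℝ 2 w) (c : Euc (d + 2))
    (t : ℝ) : t ^ (d + 1) * sphereFlux w c t
      = ∫ s in (0 : ℝ)..t, s ^ (d + 1) * sphereIntegral (Laplacian.laplacian w) c s := by
  have hcont := continuous_sphereIntegral (continuous_laplacian hw) c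
  have h := intervalIntegral.integral_eq_sub_of_hasDerivAt (a := 0) (b := t)
    (fun s _ => hasDerivAt_pow_mul_sphereFlux (by omega) hw c s)
    (Continuous.intervalIntegrable (by fun_prop) _ _)
  rw [zero_pow (by omega), zero_mul, sub_zero] at h
  exact h.symm

/-- Superharmonicity is known only near infinity. The failure inside is measured by the mass of the
compactly supported `(Δw)⁺`, which bounds the flux for every centre and radius at once. -/
theorem pow_mul_sphereFlux_le {d : ℕ} {w : Euc (d + 2) → ℝ} (hw : ContDiff ℝ 2 w) {R : ℝ}
    (h : ∀ x : Euc (d + 2), R ≤ ‖x‖ → Laplacian.laplacian w x ≤ 0) (c : Euc (d + 2)) {t : ℝ}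
    (ht : 0 ≤ t) : t ^ (d + 1) * sphereFlux w c t ≤ ∫ x, laplacianPos w x := by
  obtain ⟨h1, h2⟩ := integral_polar (by omega) (integrable_laplacianPos hw h) c
  have hc1 := continuous_sphereIntegral (continuous_laplacian hw) c
  have hc2 := continuous_sphereIntegral (continuous_laplacianPos hw) c
  rw [pow_mul_sphereFlux_eq hw, h2, intervalIntegral.integral_of_le ht]
  have hnn : ∀ r ∈ Ioi (0 : ℝ), 0 ≤ r ^ (d + 2 - 1) * sphereIntegral (laplacianPos w) c r :=
    fun r hr => mul_nonneg (pow_nonneg (le_of_lt hr) _)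
      (integral_nonneg fun s => le_max_right _ _)
  refine le_trans ?_ (setIntegral_mono_set h1
    ((ae_restrict_iff' measurableSet_Ioi).2 (Eventually.of_forall hnn))
    (Eventually.of_forall (fun r hr => hr.1 : Ioc (0 : ℝ) t ⊆ Ioi 0)))
  refine setIntegral_mono_on
    (Continuous.integrableOn_Ioc (by fun_prop)) (h1.mono_set fun r hr => hr.1)
    measurableSet_Ioc fun r hr => ?_
  exact mul_le_mul_of_nonneg_left (sphereIntegral_mono (continuous_laplacian hw)
    (continuous_laplacianPos hw) fun s => le_max_left _ _) (pow_nonneg hr.1.le _)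

theorem sphereFlux_nonpos {d : ℕ} {w : Euc (d + 2) → ℝ} (hw : ContDiff ℝ 2 w) {R : ℝ}
    (h : ∀ x : Euc (d + 2), R ≤ ‖x‖ → Laplacian.laplacian w x ≤ 0) (c : Euc (d + 2)) {t : ℝ}
    (ht : 0 < t) (htR : t ≤ ‖c‖ - R) : sphereFlux w c t ≤ 0 := by
  have h1 : t ^ (d + 1) * sphereFlux w c t ≤ 0 := by
    rw [pow_mul_sphereFlux_eq hw, intervalIntegral.integral_of_le ht.le]
    refine setIntegral_nonpos measurableSet_Ioc fun r hr => ?_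
    refine mul_nonpos_of_nonneg_of_nonpos (pow_nonneg hr.1.le _)
      (integral_nonpos fun s => h _ ?_)
    have h2 : ‖r • (s : Euc (d + 2))‖ = r := by
      rw [norm_smul, norm_eq_of_mem_sphere, mul_one, Real.norm_eq_abs, abs_of_pos hr.1]
    have h3 := norm_sub_le_norm_add c (r • (s : Euc (d + 2)))
    linarith [hr.2]
  exact nonpos_of_mul_nonpos_right h1 (by positivity)

/-- Up to radius `‖c‖ - R` the ball avoids the bad region and the sphere integrals decrease. Beyond
it their derivative is at most `A/s^(d+1)`, and integrating this to infinity gives the correction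
term. -/
theorem sphereIntegral_le_of_superharmonic {d : ℕ} (hd : 0 < d) {w : Euc (d + 2) → ℝ}
    (hw : ContDiff ℝ 2 w) {R : ℝ}
    (h : ∀ x : Euc (d + 2), R ≤ ‖x‖ → Laplacian.laplacian w x ≤ 0) {c : Euc (d + 2)}
    (hc : R < ‖c‖) {t : ℝ} (ht : 0 ≤ t) :
    sphereIntegral w c t
      ≤ sphereArea (d + 2) * w c + (∫ x, laplacianPos w x) / d * ((‖c‖ - R) ^ d)⁻¹ := by
  have hw1 : ContDiff ℝ 1 w := hw.of_le (by norm_num)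
  have hd' : (0 : ℝ) < d := by exact_mod_cast hd
  set A := ∫ x, laplacianPos w x with hA
  have hA0 : 0 ≤ A := integral_nonneg fun x => le_max_right _ _
  set t₀ := ‖c‖ - R with ht₀
  have ht0 : 0 < t₀ := by linarith
  have small : ∀ τ, 0 ≤ τ → τ ≤ t₀ → sphereIntegral w c τ ≤ sphereArea (d + 2) * w c := by
    intro τ hτ hτ0
    have h1 := intervalIntegral.integral_eq_sub_of_hasDerivAt (a := 0) (b := τ)
      (fun s _ => hasDerivAt_sphereIntegral hw1 c s)
      ((continuous_sphereFlux hw1 c).intervalIntegrable _ _)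
    rw [sphereIntegral_zero_radius, intervalIntegral.integral_of_le hτ] at h1
    have h2 : ∫ s in Ioc 0 τ, sphereFlux w c s ≤ 0 :=
      setIntegral_nonpos measurableSet_Ioc fun s hs =>
        sphereFlux_nonpos hw h c hs.1 (hs.2.trans hτ0)
    linarith
  have hpos : 0 ≤ A / d * (t₀ ^ d)⁻¹ := by positivity
  rcases le_total t t₀ with hle | hle
  · linarith [small t ht hle]
  · have h1 := le_of_hasDerivAt_nonpos (R := t₀)
      (f := fun s => sphereIntegral w c s + A / d * (s ^ d)⁻¹)
      (fun s hs => (hasDerivAt_sphereIntegral hw1 c s).add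
        ((hasDerivAt_inv_pow hd (ht0.trans_le hs)).const_mul (A / d))) (fun s hs => by
        have hs0 : 0 < s := ht0.trans_le hs
        have h2 := pow_mul_sphereFlux_le hw h c hs0.le
        have h3 : sphereFlux w c s ≤ A / s ^ (d + 1) := by
          rw [le_div_iff₀ (by positivity)]; linarith
        have h4 : A / d * -(d / s ^ (d + 1)) = -(A / s ^ (d + 1)) := by field_simp
        linarith) le_rfl hle
    have h2 := small t₀ ht0.le le_rfl
    have h3 : 0 ≤ A / d * (t ^ d)⁻¹ := by positivity
    linarith

theorem setIntegral_ball_le {d : ℕ} {w : Euc (d + 2) → ℝ} (hw : Continuous w) {c : Euc (d + 2)}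
    {B τ : ℝ} (hτ : 0 < τ) (hB : ∀ t, 0 ≤ t → sphereIntegral w c t ≤ B) (hB0 : 0 ≤ B) :
    ∫ x in Metric.ball c τ, w x ≤ τ ^ (d + 2) * B := by
  have hint : Integrable ((Metric.ball c τ).indicator w) := by
    rw [integrable_indicator_iff measurableSet_ball]
    exact (hw.continuousOn.integrableOn_compact (isCompact_closedBall c τ)).mono_set
      Metric.ball_subset_closedBall
  obtain ⟨h1, h2⟩ := integral_polar (by omega) hint c
  have hmem : ∀ r : ℝ, 0 < r → ∀ s : Metric.sphere (0 : Euc (d + 2)) 1,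
      c + r • (s : Euc (d + 2)) ∈ Metric.ball c τ ↔ r < τ := by
    intro r hr s
    rw [Metric.mem_ball, dist_eq_norm, add_sub_cancel_left, norm_smul, norm_eq_of_mem_sphere,
      mul_one, Real.norm_eq_abs, abs_of_pos hr]
  have hin : ∀ r ∈ Ioo 0 τ, sphereIntegral ((Metric.ball c τ).indicator w) c r
      = sphereIntegral w c r := fun r hr =>
    integral_congr_ae (Eventually.of_forall fun s =>
      indicator_of_mem ((hmem r hr.1 s).2 hr.2) _)
  have hout : ∀ r ∈ Ioi (0 : ℝ) \ Ioo 0 τ,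
      r ^ (d + 2 - 1) * sphereIntegral ((Metric.ball c τ).indicator w) c r = 0 := by
    intro r hr
    have h3 : sphereIntegral ((Metric.ball c τ).indicator w) c r = 0 := by
      refine integral_eq_zero_of_ae (Eventually.of_forall fun s => indicator_of_notMem ?_ _)
      rw [hmem r hr.1 s]
      exact fun hlt => hr.2 ⟨hr.1, hlt⟩
    rw [h3, mul_zero]
  rw [← integral_indicator measurableSet_ball, h2,
    setIntegral_eq_of_subset_of_forall_sdiff_eq_zero measurableSet_Ioi
      (fun r hr => hr.1 : Ioo 0 τ ⊆ Ioi 0) hout]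
  calc _ ≤ ∫ r in Ioo 0 τ, τ ^ (d + 1) * B := by
        refine setIntegral_mono_on (h1.mono_set fun r hr => hr.1)
          (integrableOn_const (by simp)) measurableSet_Ioo fun r hr => ?_
        rw [hin r hr]
        have := hB r hr.1.le
        calc _ ≤ r ^ (d + 1) * B := mul_le_mul_of_nonneg_left this (pow_nonneg hr.1.le _)
          _ ≤ _ := mul_le_mul_of_nonneg_right (pow_le_pow_left₀ hr.1.le hr.2.le _) hB0
    _ = τ ^ (d + 2) * B := by
        rw [setIntegral_const, smul_eq_mul, measureReal_def, Real.volume_Ioo, sub_zero,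
          ENNReal.toReal_ofReal hτ.le]
        ring

/-! ### Completeness bounds the decay of the spherical means -/

theorem exists_norm_eq_le_sphericalMean {n : ℕ} (hn : 0 < n) {u : Euc n → ℝ} (hu : Continuous u)
    {r : ℝ} (hr : 0 ≤ r) : ∃ c : Euc n, ‖c‖ = r ∧ u c ≤ sphericalMean u r := by
  have hω := sphereArea_pos hn
  have hne : sphereMeasure n ≠ 0 := by
    intro h
    rw [sphereArea, h] at hω
    simp at hω
  obtain ⟨s, hs⟩ := exists_le_average hne
    (integrable_sphere (g := fun s => u (0 + r • (s : Euc n))) (by fun_prop))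
  refine ⟨0 + r • (s : Euc n), ?_, hs.trans (le_of_eq ?_)⟩
  · rw [zero_add, norm_smul, norm_eq_of_mem_sphere, mul_one, Real.norm_eq_abs, abs_of_nonneg hr]
  · rw [average_eq, smul_eq_mul, sphericalMean, div_eq_inv_mul]
    rfl

/-- The exponent `d/2 = (n-2)/2` is that of the conformal Laplacian: with it the gradient term
cancels exactly. -/
theorem laplacian_exp_nonpos {d : ℕ} {u : Euc (d + 2) → ℝ} (hu : ContDiff ℝ 2 u)
    {x : Euc (d + 2)} (h : 0 ≤ scalarCurvature (conformalMetric u) x) :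
    Laplacian.laplacian (fun y => Real.exp (d / 2 * u y)) x ≤ 0 := by
  have h1 := laplacian_le_of_scalarCurvature (by omega) hu h
  rw [zero_div, zero_mul, sub_zero] at h1
  push_cast at h1
  rw [laplacian_exp_mul hu]
  refine mul_nonpos_of_nonneg_of_nonpos (by positivity) ?_
  have h2 : ((d : ℝ) + 2 - 2) / 2 * gradSq u x = d / 2 * gradSq u x := by ring
  linarith

/-- With `y = r^β e^a` this is `y ≤ 1 + y^{d/2}`, which holds because `d/2 ≥ 1`. It trades `e^u` for
the superharmonic `e^{(d/2)u}`. -/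
theorem exp_le_add_rpow {d : ℕ} (hd : 2 ≤ d) {β r a : ℝ} (hr : 0 < r) :
    Real.exp a ≤ r ^ (-β) + r ^ (d / 2 * β - β) * Real.exp (d / 2 * a) := by
  have hd' : (2 : ℝ) ≤ d := by exact_mod_cast hd
  rw [Real.rpow_def_of_pos hr, Real.rpow_def_of_pos hr, ← Real.exp_add]
  rcases le_total a (Real.log r * -β) with h | h
  · have := Real.exp_le_exp.2 h
    have := Real.exp_pos (Real.log r * (d / 2 * β - β) + d / 2 * a)
    linarith
  · have h1 : a ≤ Real.log r * (d / 2 * β - β) + d / 2 * a := by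
      nlinarith
    have := Real.exp_le_exp.2 h1
    have := Real.exp_pos (Real.log r * -β)
    linarith

/-- On the sphere of radius `r` some point `c` has `u c` at most the mean. The mean value inequality
for `e^{(d/2)u}` centred at `c` then controls its integral over the ball of radius `4r` about `c`,
which contains the annulus. -/
theorem exists_integral_annulus_exp_le {d : ℕ} (hd : 2 ≤ d) {u : Euc (d + 2) → ℝ}
    (hu : ContDiff ℝ 2 u) {R β K : ℝ} (hR : 1 ≤ R) (hβ : β ≤ 2)
    (hcurv : ∀ x : Euc (d + 2), R ≤ ‖x‖ → 0 ≤ scalarCurvature (conformalMetric u) x)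
    (hmean : ∀ r ≥ R, sphericalMean u r ≤ K - β * Real.log r) :
    ∃ C, 0 ≤ C ∧ ∀ r ≥ 2 * R,
      ∫ x in {x : Euc (d + 2) | r ≤ ‖x‖ ∧ ‖x‖ < 2 * r}, Real.exp (u x)
        ≤ C * (r ^ (d + 2) * r ^ (-β)) := by
  have hd0 : (0 : ℝ) < d := by exact_mod_cast (by omega : 0 < d)
  have hω := sphereArea_pos (show 0 < d + 2 by omega)
  have hcu := hu.continuous
  set w : Euc (d + 2) → ℝ := fun y => Real.exp (d / 2 * u y) with hw
  have hwd : ContDiff ℝ 2 w := (contDiff_const.mul hu).exp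
  have hwc := hwd.continuous
  have hsup : ∀ x : Euc (d + 2), R ≤ ‖x‖ → Laplacian.laplacian w x ≤ 0 := fun x hx =>
    laplacian_exp_nonpos hu (hcurv x hx)
  set A := ∫ x, laplacianPos w x with hA
  have hA0 : 0 ≤ A := integral_nonneg fun x => le_max_right _ _
  set C₁ := sphereArea (d + 2) * Real.exp (d / 2 * K) + A / d * 2 ^ d with hC₁
  have hC10 : 0 ≤ C₁ := by positivity
  set V := (volume : Measure (Euc (d + 2))).real (Metric.ball 0 1) with hV
  have hV0 : 0 ≤ V := measureReal_nonneg
  refine ⟨4 ^ (d + 2) * (V + C₁), by positivity, fun r hr => ?_⟩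
  have hr0 : 0 < r := by linarith
  have hr1 : 1 ≤ r := by linarith
  obtain ⟨c, hc, huc⟩ := exists_norm_eq_le_sphericalMean (n := d + 2) (by omega) hcu hr0.le
  have hwc_le : w c ≤ Real.exp (d / 2 * K) * r ^ (-(d / 2 * β)) := by
    rw [Real.rpow_def_of_pos hr0, ← Real.exp_add]
    refine Real.exp_le_exp.2 ?_
    have h1 := huc.trans (hmean r (by linarith))
    have h2 := mul_le_mul_of_nonneg_left h1 (show (0 : ℝ) ≤ d / 2 by positivity)
    linarith
  -- `r ≥ 2R` gives `‖c‖ - R ≥ r/2`. The bound `β ≤ 2` is used here: the correction of order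
  -- `r^(-d)` must not exceed the main term `r^(-(d/2)β)`.
  have hinv : ((‖c‖ - R) ^ d)⁻¹ ≤ 2 ^ d * r ^ (-(d / 2 * β)) := by
    have h1 : (r / 2) ^ d ≤ (‖c‖ - R) ^ d := pow_le_pow_left₀ (by positivity) (by linarith) _
    have h2 : ((‖c‖ - R) ^ d)⁻¹ ≤ ((r / 2) ^ d)⁻¹ := inv_anti₀ (by positivity) h1
    have h3 : ((r / 2) ^ d)⁻¹ = 2 ^ d * r ^ (-(d : ℝ)) := by
      rw [Real.rpow_neg hr0.le, Real.rpow_natCast, div_pow]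
      field_simp
    have h4 : r ^ (-(d : ℝ)) ≤ r ^ (-(d / 2 * β)) :=
      Real.rpow_le_rpow_of_exponent_le hr1 (by nlinarith)
    rw [h3] at h2
    exact h2.trans (by gcongr)
  have hB : ∀ t, 0 ≤ t → sphereIntegral w c t ≤ C₁ * r ^ (-(d / 2 * β)) := by
    intro t ht
    refine (sphereIntegral_le_of_superharmonic (by omega) hwd hsup (by linarith) ht).trans ?_
    have h1 := mul_le_mul_of_nonneg_left hwc_le hω.le
    have h2 := mul_le_mul_of_nonneg_left hinv (show 0 ≤ A / d by positivity)
    rw [hC₁]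
    linarith
  have hball := setIntegral_ball_le hwc (τ := 4 * r) (by positivity) hB (by positivity)
  have hsub : {x : Euc (d + 2) | r ≤ ‖x‖ ∧ ‖x‖ < 2 * r} ⊆ Metric.ball c (4 * r) := by
    intro x hx
    rw [Metric.mem_ball, dist_eq_norm]
    have := norm_sub_le x c
    linarith [hx.2]
  have hio : ∀ f : Euc (d + 2) → ℝ, Continuous f → IntegrableOn f (Metric.ball c (4 * r)) :=
    fun f hf => (hf.continuousOn.integrableOn_compact (isCompact_closedBall c _)).mono_set
      Metric.ball_subset_closedBall
  have hvol : (volume : Measure (Euc (d + 2))).real (Metric.ball c (4 * r))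
      = (4 * r) ^ (d + 2) * V := by
    rw [hV, measureReal_def, Measure.addHaar_ball_of_pos _ _ (by positivity),
      finrank_euclideanSpace_fin, ENNReal.toReal_mul, ENNReal.toReal_ofReal (by positivity)]
    rfl
  calc _ ≤ ∫ x in Metric.ball c (4 * r), Real.exp (u x) :=
        setIntegral_mono_set (hio _ (by fun_prop))
          (Eventually.of_forall fun x => (Real.exp_pos _).le) (Eventually.of_forall hsub)
    _ ≤ ∫ x in Metric.ball c (4 * r), (r ^ (-β) + r ^ (d / 2 * β - β) * w x) :=
        setIntegral_mono_on (hio _ (by fun_prop)) (hio _ (by fun_prop)) measurableSet_ball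
          fun x _ => exp_le_add_rpow hd hr0
    _ = (4 * r) ^ (d + 2) * V * r ^ (-β)
          + r ^ (d / 2 * β - β) * ∫ x in Metric.ball c (4 * r), w x := by
        rw [integral_add (hio _ (by fun_prop)) (hio _ (by fun_prop)), setIntegral_const,
          integral_const_mul, smul_eq_mul, hvol]
    _ ≤ (4 * r) ^ (d + 2) * V * r ^ (-β)
          + r ^ (d / 2 * β - β) * ((4 * r) ^ (d + 2) * (C₁ * r ^ (-(d / 2 * β)))) := by
        gcongr
    _ = _ := by
        have h1 : r ^ (d / 2 * β - β) * r ^ (-(d / 2 * β)) = r ^ (-β) := by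
          rw [← Real.rpow_add hr0]; congr 1; ring
        rw [mul_pow]
        linear_combination (4 ^ (d + 2) * r ^ (d + 2) * C₁) * h1

theorem lintegral_annulus_le {d : ℕ} {u : Euc (d + 2) → ℝ} (hu : Continuous u) {r C β : ℝ}
    (hr : 0 < r) (h : ∫ x in {x : Euc (d + 2) | r ≤ ‖x‖ ∧ ‖x‖ < 2 * r}, Real.exp (u x)
        ≤ C * (r ^ (d + 2) * r ^ (-β))) :
    ∫⁻ x in {x : Euc (d + 2) | r ≤ ‖x‖ ∧ ‖x‖ < 2 * r},
      ENNReal.ofReal (Real.exp (u x) / ‖x‖ ^ (d + 1)) ≤ ENNReal.ofReal (C * r ^ (1 - β)) := by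
  set S := {x : Euc (d + 2) | r ≤ ‖x‖ ∧ ‖x‖ < 2 * r} with hS
  have hSm : MeasurableSet S :=
    (measurableSet_le measurable_const measurable_norm).inter
      (measurableSet_lt measurable_norm measurable_const)
  have hint : IntegrableOn (fun x => Real.exp (u x)) S :=
    ((Real.continuous_exp.comp hu).continuousOn.integrableOn_compact
      (isCompact_closedBall 0 (2 * r))).mono_set fun x hx => by
        rw [mem_closedBall_zero_iff]; exact hx.2.le
  calc _ ≤ ∫⁻ x in S, ENNReal.ofReal (r ^ (d + 1))⁻¹ * ENNReal.ofReal (Real.exp (u x)) := by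
        refine setLIntegral_mono' hSm fun x hx => ?_
        rw [← ENNReal.ofReal_mul (by positivity)]
        refine ENNReal.ofReal_le_ofReal ?_
        rw [div_eq_inv_mul]
        have := pow_le_pow_left₀ hr.le hx.1 (d + 1)
        gcongr
    _ = ENNReal.ofReal (r ^ (d + 1))⁻¹ * ENNReal.ofReal (∫ x in S, Real.exp (u x)) := by
        rw [lintegral_const_mul' _ _ ENNReal.ofReal_ne_top,
          ofReal_integral_eq_lintegral_ofReal hint
            (Eventually.of_forall fun x => (Real.exp_pos _).le)]
    _ ≤ ENNReal.ofReal (r ^ (d + 1))⁻¹ * ENNReal.ofReal (C * (r ^ (d + 2) * r ^ (-β))) := by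
        gcongr
    _ = _ := by
        rw [← ENNReal.ofReal_mul (by positivity)]
        congr 1
        rw [sub_eq_add_neg, Real.rpow_add hr, Real.rpow_one]
        field_simp
        ring

/-- The weight `|x|^{-(n-1)}` cancels the polar Jacobian, so the integral of `e^u/|x|^{n-1}` over
the exterior region is the integral over directions of ray lengths. The annulus bounds make it
finite, while completeness makes it infinite. -/
theorem not_isCompleteMetric_of_sphericalMean_le {d : ℕ} (hd : 2 ≤ d) {u : Euc (d + 2) → ℝ}
    (hu : ContDiff ℝ 2 u) {R β K : ℝ} (hR : 1 ≤ R) (hβ1 : 1 < β) (hβ : β ≤ 2)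
    (hcurv : ∀ x : Euc (d + 2), R ≤ ‖x‖ → 0 ≤ scalarCurvature (conformalMetric u) x)
    (hmean : ∀ r ≥ R, sphericalMean u r ≤ K - β * Real.log r) :
    ¬ IsCompleteMetric (conformalMetric u) := by
  intro hcomp
  obtain ⟨C, hC0, hC⟩ := exists_integral_annulus_exp_le hd hu hR hβ hcurv hmean
  have hcu := hu.continuous
  set ρ : ℕ → ℝ := fun k => 2 ^ k * (2 * R) with hρ
  have hρR : ∀ k, 2 * R ≤ ρ k := fun k =>
    le_mul_of_one_le_left (by linarith) (one_le_pow₀ one_le_two)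
  set S : ℕ → Set (Euc (d + 2)) := fun k => {x | ρ k ≤ ‖x‖ ∧ ‖x‖ < 2 * ρ k} with hS
  set T : Set (Euc (d + 2)) := {x | 2 * R ≤ ‖x‖} with hT
  have hTm : MeasurableSet T := measurableSet_le measurable_const measurable_norm
  set F : Euc (d + 2) → ℝ≥0∞ := fun x => ENNReal.ofReal (Real.exp (u x) / ‖x‖ ^ (d + 1)) with hF
  have hFm : Measurable F := by
    have := hcu.measurable
    fun_prop
  have hcover : T ⊆ ⋃ k, S k := by
    intro x hx
    have hx' : 2 * R ≤ ‖x‖ := hx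
    obtain ⟨k, hk1, hk2⟩ := exists_nat_pow_near
      (show (1 : ℝ) ≤ ‖x‖ / (2 * R) by rw [le_div_iff₀ (by linarith)]; linarith) one_lt_two
    rw [le_div_iff₀ (by linarith)] at hk1
    rw [div_lt_iff₀ (by linarith), pow_succ] at hk2
    exact mem_iUnion.2 ⟨k, hk1, by simp only [hρ]; linarith⟩
  have hfin : ∫⁻ x in T, F x < ⊤ := by
    refine lt_of_le_of_lt ((lintegral_mono_set hcover).trans (lintegral_iUnion_le _ _)) ?_
    refine lt_of_le_of_lt (ENNReal.tsum_le_tsum fun k =>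
      lintegral_annulus_le hcu (by linarith [hρR k]) (hC (ρ k) (hρR k))) ?_
    -- A geometric series of ratio `2^(1-β)`, which is less than `1` precisely because `β > 1`.
    have hsum : Summable fun k => C * ρ k ^ (1 - β) := by
      have hgeo : Summable fun k : ℕ => ((2 : ℝ) ^ (1 - β)) ^ k :=
        summable_geometric_of_lt_one (by positivity)
          (Real.rpow_lt_one_of_one_lt_of_neg one_lt_two (by linarith))
      have := (hgeo.mul_right ((2 * R) ^ (1 - β))).mul_left C
      refine this.congr fun k => ?_
      simp only [hρ]
      have e : ((2 : ℝ) ^ k) ^ (1 - β) = (2 ^ (1 - β)) ^ k := by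
        rw [← Real.rpow_natCast, ← Real.rpow_natCast, ← Real.rpow_mul zero_le_two,
          ← Real.rpow_mul zero_le_two, mul_comm]
      rw [Real.mul_rpow (x := 2 ^ k) (y := 2 * R) (by positivity) (by linarith), e]
    exact hsum.tsum_ofReal_lt_top
  have hω := sphereArea_pos (show 0 < d + 2 by omega)
  have htop : ∫⁻ x in T, F x = ⊤ := by
    rw [← lintegral_indicator hTm, lintegral_polar_swap (by omega) (hFm.indicator hTm)]
    have hray : ∀ s : Metric.sphere (0 : Euc (d + 2)) 1, ∫⁻ r in Ioi (0 : ℝ),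
        ENNReal.ofReal (r ^ (d + 2 - 1)) * T.indicator F (r • (s : Euc (d + 2))) = ⊤ := by
      intro s
      have hs : ‖(s : Euc (d + 2))‖ = 1 := norm_eq_of_mem_sphere s
      rw [eq_top_iff, ← lintegral_ray_eq_top hcu hcomp hs (2 * R)]
      refine le_trans (setLIntegral_mono' measurableSet_Ioi fun r hr => ?_)
        (lintegral_mono_set (Ioi_subset_Ioi (by linarith : (0 : ℝ) ≤ 2 * R)))
      have hr' : 2 * R < r := hr
      have hr0 : 0 < r := by linarith
      have hnorm : ‖r • (s : Euc (d + 2))‖ = r := by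
        rw [norm_smul, hs, mul_one, Real.norm_eq_abs, abs_of_pos hr0]
      have hmem : r • (s : Euc (d + 2)) ∈ T := by
        change 2 * R ≤ ‖r • (s : Euc (d + 2))‖
        rw [hnorm]; exact hr'.le
      rw [indicator_of_mem hmem, hF]
      simp only
      rw [hnorm, ← ENNReal.ofReal_mul (by positivity), show d + 2 - 1 = d + 1 from rfl,
        mul_div_cancel₀ _ (by positivity)]
    rw [lintegral_congr hray, lintegral_const]
    refine ENNReal.top_mul ?_
    intro h
    rw [sphereArea, measureReal_def, h] at hω
    simp at hω
  exact absurd htop hfin.ne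

/-! ### The total Q-curvature -/

/-- The normalizing constant `(n-1)! |𝕊ⁿ| / 2`. -/
def halfSphereTotal (n : ℕ) : ℝ := ((n - 1).factorial : ℝ) * sphereVolume n / 2

theorem halfSphereTotal_pos {n : ℕ} : 0 < halfSphereTotal n := by
  have : 0 < sphereVolume n := sphereArea_pos (Nat.succ_pos n)
  unfold halfSphereTotal
  positivity

/-- The total `Q`-curvature divided by `(n-1)! |𝕊ⁿ| / 2`. -/
def normalizedTotalQ {n : ℕ} (u : Euc n → ℝ) : ℝ :=
  (∫ x, qCurvature u x * Real.exp (n * u x)) / halfSphereTotal n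

theorem tendsto_mul_deriv_normalizedTotalQ {n : ℕ} (hn : 4 ≤ n) (hn_even : Even n) {u : Euc n → ℝ}
    (hu : ContDiff ℝ ∞ u) (hint : Integrable fun x => qCurvature u x * Real.exp (n * u x))
    {K R : ℝ} (hK : ∀ r ≥ R, |r * (sphereFlux u 0 r / sphereArea n)| ≤ K) :
    Tendsto (fun r => r * (sphereFlux u 0 r / sphereArea n)) atTop (𝓝 (-normalizedTotalQ u)) := by
  obtain ⟨m, hm⟩ := hn_even
  obtain rfl : n = 2 * m := by omega
  simp only [qCurvature_mul_exp, show 2 * m / 2 = m by omega] at hint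
  have h := tendsto_mul_deriv_sphericalMean (by omega) hu hint hK
  simpa only [normalizedTotalQ, halfSphereTotal, qCurvature_mul_exp,
    show 2 * m / 2 = m by omega] using h

theorem exists_norm_bound_of_eventually_cocompact {n : ℕ} {p : Euc n → Prop}
    (h : ∀ᶠ x in cocompact (Euc n), p x) : ∃ R : ℝ, 1 ≤ R ∧ ∀ x, R ≤ ‖x‖ → p x := by
  obtain ⟨R, _, hR⟩ := (hasBasis_cobounded_norm (E := Euc n)).eventually_iff.1
    (by rwa [Metric.cobounded_eq_cocompact])
  exact ⟨max R 1, le_max_right _ _, fun x hx => hR ((le_max_left _ _).trans hx)⟩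

/-- If `R_g ≥ 0` near infinity, then `r ū'(r)` converges to minus the normalized total
`Q`-curvature, which lies in `[0, 1]`. -/
theorem normalizedTotalQ_mem {d : ℕ} (hd : 2 ≤ d) (hd_even : Even (d + 2)) {u : Euc (d + 2) → ℝ}
    (hu : ContDiff ℝ ∞ u) (hcomp : IsCompleteMetric (conformalMetric u))
    (hint : Integrable fun x => qCurvature u x * Real.exp ((d + 2 : ℕ) * u x)) {R : ℝ} (hR : 1 ≤ R)
    (h : ∀ x : Euc (d + 2), R ≤ ‖x‖ → 0 ≤ scalarCurvature (conformalMetric u) x) :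
    Tendsto (fun r => r * (sphereFlux u 0 r / sphereArea (d + 2))) atTop
      (𝓝 (-normalizedTotalQ u)) ∧ 0 ≤ normalizedTotalQ u ∧ normalizedTotalQ u ≤ 1 := by
  have hu2 := contDiff_two_of_smooth hu
  have H := radialRiccati_sphericalMean hu2 hR h
  obtain ⟨K, hK⟩ := H.bounded (by omega)
  have hlim := tendsto_mul_deriv_normalizedTotalQ (by omega) hd_even hu hint hK
  refine ⟨hlim, H.limit_nonneg (by omega) hlim, ?_⟩
  by_contra! hgt
  set α := normalizedTotalQ u with hα
  -- Any exponent with `1 < β < α` is suitable for the decay of the mean; the cap at `2` is required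
  -- by the annulus estimate.
  set β := min 2 ((1 + α) / 2) with hβ
  have hβα : β < α := lt_of_le_of_lt (min_le_right _ _) (by linarith)
  have hβ1 : 1 < β := lt_min one_lt_two (by linarith)
  -- The logarithmic lower bound is applied to minus the mean, giving the upper bound `ū ≤ K' - β
  -- log r`.
  have hneg : Tendsto (fun r => r * -(sphereFlux u 0 r / sphereArea (d + 2))) atTop
      (𝓝 (-(-α))) := by
    simpa only [mul_neg] using hlim.neg
  obtain ⟨K', hK'⟩ := exists_log_le_of_tendsto (fun r => (H.hasDerivAt r).neg) hneg
    (neg_lt_neg hβα)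
  obtain ⟨R', hR'⟩ := eventually_atTop.1 hK'
  refine not_isCompleteMetric_of_sphericalMean_le (K := K') (R := max R R') hd hu2
    (hR.trans (le_max_left _ _)) hβ1 (min_le_left _ _)
    (fun x hx => h x ((le_max_left _ _).trans hx)) (fun r hr => ?_) hcomp
  have h1 := hR' r ((le_max_right _ _).trans hr)
  rw [Pi.neg_apply] at h1
  linarith

theorem one_sub_half_le_normalizedTotalQ {d : ℕ} (hd : 2 ≤ d) {u : Euc (d + 2) → ℝ}
    (hu : ContDiff ℝ 2 u) {R C p : ℝ} (hR : 1 ≤ R) (hC : 0 < C)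
    (h : ∀ x : Euc (d + 2), R ≤ ‖x‖ →
      C * ‖x‖ ^ (-p) ≤ scalarCurvature (conformalMetric u) x)
    (hlim : Tendsto (fun r => r * (sphereFlux u 0 r / sphereArea (d + 2))) atTop
      (𝓝 (-normalizedTotalQ u))) : 1 - p / 2 ≤ normalizedTotalQ u := by
  refine one_sub_half_le_of_laplacian_le (R := R) (c := C / (2 * ((d : ℝ) + 1))) (p := p)
    (by omega) (by positivity) (hasDerivAt_sphericalMean (hu.of_le (by norm_num)))
    (hasDerivAt_sphericalMean_flux hu) (fun r hr => ?_) hlim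
  have hr0 : 0 < r := by linarith [show R ≤ r from hr]
  have h1 := sphereIntegral_laplacian_le (by omega) hu (r := r) (b := C * r ^ (-p)) hr0.le
    (by positivity) (fun x hx => by have := h x (by rw [hx]; exact hr); rwa [hx] at this)
  have h2 : 0 ≤ (((d + 2 : ℕ) : ℝ) - 2) / 2 * (sphereFlux u 0 r / sphereArea (d + 2)) ^ 2 := by
    push_cast
    have : (0 : ℝ) ≤ ((d : ℝ) + 2 - 2) / 2 := by
      rw [add_sub_cancel_right]; positivity
    positivity
  have h3 : C * r ^ (-p) / (2 * (((d + 2 : ℕ) : ℝ) - 1)) = C / (2 * ((d : ℝ) + 1)) * r ^ (-p) := by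
    rw [show (((d + 2 : ℕ) : ℝ) - 1) = (d : ℝ) + 1 by push_cast; ring]
    ring
  rw [h3] at h1
  change _ ≤ -(C / (2 * ((d : ℝ) + 1)) * r ^ (-p)
    * Real.exp (2 * (sphereIntegral u 0 r / sphereArea (d + 2))))
  linarith

end ConformalQ

end

/-! ### Assembly of the main theorem -/

theorem mainTheorem3 (n : ℕ) (hn : 4 ≤ n) (hn_even : Even n)
    (u : EuclideanSpace ℝ (Fin n) → ℝ) (hu : ContDiff ℝ ∞ u)
    (hcomplete : ConformalQ.IsCompleteMetric (ConformalQ.conformalMetric u))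
    (hfinite : Integrable (fun x => ConformalQ.qCurvature u x * Real.exp (n * u x)) volume) :
    -- (1) `R_g ≥ 0` near infinity
    ((∀ᶠ x in cocompact (EuclideanSpace ℝ (Fin n)),
        0 ≤ ConformalQ.scalarCurvature (ConformalQ.conformalMetric u) x) →
      0 ≤ (∫ x, ConformalQ.qCurvature u x * Real.exp (n * u x)) ∧
      (∫ x, ConformalQ.qCurvature u x * Real.exp (n * u x))
        ≤ ((n - 1).factorial : ℝ) * ConformalQ.sphereVolume n / 2) ∧
    -- (2) `R_g ≥ C |x|^{-p}` near infinity
    (∀ C p : ℝ, 0 < C → 0 ≤ p →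
      (∀ᶠ x in cocompact (EuclideanSpace ℝ (Fin n)),
        C * ‖x‖ ^ (-p) ≤ ConformalQ.scalarCurvature (ConformalQ.conformalMetric u) x) →
      ((n - 1).factorial : ℝ) * ConformalQ.sphereVolume n / 2 * max 0 (1 - p / 2)
        ≤ (∫ x, ConformalQ.qCurvature u x * Real.exp (n * u x)) ∧
      (∫ x, ConformalQ.qCurvature u x * Real.exp (n * u x))
        ≤ ((n - 1).factorial : ℝ) * ConformalQ.sphereVolume n / 2) ∧
    -- in particular, `R_g ≥ C > 0` near infinity
    (∀ C : ℝ, 0 < C →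
      (∀ᶠ x in cocompact (EuclideanSpace ℝ (Fin n)),
        C ≤ ConformalQ.scalarCurvature (ConformalQ.conformalMetric u) x) →
      (∫ x, ConformalQ.qCurvature u x * Real.exp (n * u x))
        = ((n - 1).factorial : ℝ) * ConformalQ.sphereVolume n / 2) := by
  obtain ⟨d, rfl⟩ : ∃ d, n = d + 2 := ⟨n - 2, by omega⟩
  have hd : 2 ≤ d := by omega
  have hu2 := ConformalQ.contDiff_two_of_smooth hu
  have hc := ConformalQ.halfSphereTotal_pos (n := d + 2)
  have hI : ∫ x, ConformalQ.qCurvature u x * Real.exp ((d + 2 : ℕ) * u x)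
      = ConformalQ.halfSphereTotal (d + 2) * ConformalQ.normalizedTotalQ u := by
    rw [ConformalQ.normalizedTotalQ]
    field_simp
  rw [show ((d + 2 - 1).factorial : ℝ) * ConformalQ.sphereVolume (d + 2) / 2
    = ConformalQ.halfSphereTotal (d + 2) from rfl, hI]
  have upper : ∀ {α : ℝ}, α ≤ 1 → ConformalQ.halfSphereTotal (d + 2) * α
      ≤ ConformalQ.halfSphereTotal (d + 2) := fun h => mul_le_of_le_one_right hc.le h
  have decay : ∀ C p : ℝ, 0 < C →
      (∀ᶠ x in cocompact (EuclideanSpace ℝ (Fin (d + 2))),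
        C * ‖x‖ ^ (-p) ≤ ConformalQ.scalarCurvature (ConformalQ.conformalMetric u) x) →
      max 0 (1 - p / 2) ≤ ConformalQ.normalizedTotalQ u ∧
        ConformalQ.normalizedTotalQ u ≤ 1 := by
    intro C p hC h
    obtain ⟨R, hR, hx⟩ := ConformalQ.exists_norm_bound_of_eventually_cocompact h
    obtain ⟨hlim, h0, h1⟩ := ConformalQ.normalizedTotalQ_mem hd hn_even hu hcomplete hfinite hR
      (fun x hxR => le_trans (by positivity) (hx x hxR))
    exact ⟨max_le h0 (ConformalQ.one_sub_half_le_normalizedTotalQ hd hu2 hR hC hx hlim), h1⟩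
  refine ⟨fun h => ?_, fun C p hC _ h => ?_, fun C hC h => ?_⟩
  · obtain ⟨R, hR, hx⟩ := ConformalQ.exists_norm_bound_of_eventually_cocompact h
    obtain ⟨_, h0, h1⟩ := ConformalQ.normalizedTotalQ_mem hd hn_even hu hcomplete hfinite hR hx
    exact ⟨mul_nonneg hc.le h0, upper h1⟩
  · obtain ⟨h0, h1⟩ := decay C p hC h
    exact ⟨mul_le_mul_of_nonneg_left h0 hc.le, upper h1⟩
  -- A constant lower bound is the case `p = 0`, where the two bounds on the normalized total are
  -- both `1`.
  · obtain ⟨h0, h1⟩ := decay C 0 hC (by simpa using h)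
    have h2 := (le_max_right _ _).trans h0
    rw [zero_div, sub_zero] at h2
    rw [le_antisymm h1 h2, mul_one]
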